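/- **Setting.** A team $R$ consists of $n\ge 2$ identical anonymous robots, points in the Euclidean plane $\mathbb R^2$, all running the same deterministic algorithm. It has fixed capabilities: its movements are rigid or non-rigid, and its fixed local coordinate systems (axes, unit of length, handedness; origin at the robot) agree to a specified degree, i.e. the adversary chooses them from a given nonempty set of joint assignments, which is closed under permuting the robots and under a common change of the global coordinate system (e.g. full disorientation, chirality, common coordinate system). Let $\mathcal R$ be the class of all such teams. Every robot carries finitely many lights with finitely many colors, all robots having the same initial colors. Time is divided into rounds. In a round each active robot simultaneously *Looks* (takes a snapshot, in its local coordinates, of the multiset of positions of the other robots, i.e. with strong multiplicity detection), *Computes* from what it sees a destination and, for every light, either a new color or the decision to leave the light unchanged, and *Moves*: it reaches the destination if movements are rigid; if not, an adversary may stop it on the segment to the destination, but for some $\delta>0$ unknown to the robots it covers at least the minimum of $\delta$ and the distance to the destination. Inactive robots change nothing. Lights persist between rounds; there is no other memory. In $\mathcal{LUMI}$ a robot sees its own lights and those of the other robots (each attached to the position of its robot); in $\mathcal{FCOM}$ only those of the others; in $\mathcal{FSTA}$ only its own; in $\mathcal{OBLOT}$ none. An activation sequence is a sequence $e_1,e_2,\dots$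 of subsets of $R$ in which every robot occurs infinitely often. Under SSYNCH ($S$) the adversary may use every activation sequence with all $e_i\neq\emptyset$. Under RSYNCH ($RS$) it may use those that moreover satisfy: either $e_i=R$ for all $i$, or there is $p\ge 0$ with $e_i=R$ for $i\le p$ and $\emptyset\ne e_i\neq R$, $e_i\cap e_{i+1}=\emptyset$ for all $i>p$. A problem for $n$ robots consists of a set of valid initial placements in $(\mathbb R^2)^n$ and a set of valid infinite sequences of placements that is invariant under stuttering (repeating entries finitely often, or undoing such repetitions). For a model $M$, a scheduler $S$ and a team $R$, let $Task(M,S;R)$ be the set of problems for which some algorithm produces, from every valid initial placement with all lights in their initial colors, and against every choice of the adversary (admissible coordinate systems, $\delta$, activation sequence, stops of the moves), a valid sequence of placements. Write $M_1^{S_1}\ge M_2^{S_2}$ if $Task(M_1,S_1;R)\supseteq Task(M_2,S_2;R)$ for all $R\in\mathcal R$; $M_1^{S_1}>M_2^{S_2}$ if $M_1^{S_1}\ge M_2^{S_2}$ and $Task(M_1,S_1;R)\setminus Task(M_2,S_2;R)\neq\emptyset$ for some $R\in\mathcal R$; and $M_1^{S_1}\equiv M_2^{S_2}$ if $M_1^{S_1}\ge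 M_2^{S_2}$ and $M_2^{S_2}\ge M_1^{S_1}$. **Theorem.** $$\mathcal{FCOM}^{RS}\equiv\mathcal{LUMI}^{RS}\equiv\mathcal{LUMI}^{S},\qquad \mathcal{FCOM}^{RS}>\mathcal{FSTA}^{RS}>\mathcal{OBLOT}^{RS}.$$ -/

import Mathlib

namespace LCMRobots

noncomputable section

/-! ### Local coordinate systems

The Euclidean plane is `ℂ`. -/

/-- The axes, the unit of length and the handedness of a robot's local coordinate system. The
local vector `v` is the global vector `u * v`, or `u * conj v` if the system is mirrored, so that
`‖u‖` is the unit of distance and `u / ‖u‖` the direction of the first axis. These maps are all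
the linear similarities of the plane. The origin is the current position of the robot. -/
structure Frame where
  u : ℂ
  u_ne_zero : u ≠ 0
  mirror : Bool

namespace Frame

/-- Local vector to global vector. -/
def toGlobal (F : Frame) (v : ℂ) : ℂ :=
  F.u * (if F.mirror then (starRingEnd ℂ) v else v)

/-- Global vector to local vector. -/
def toLocal (F : Frame) (w : ℂ) : ℂ :=
  if F.mirror then (starRingEnd ℂ) (w / F.u) else w / F.u

theorem toLocal_toGlobal (F : Frame) (v : ℂ) : F.toLocal (F.toGlobal v) = v := by
  rcases F with ⟨u, hu, m⟩
  cases m <;> simp [toLocal, toGlobal, hu]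

theorem toGlobal_toLocal (F : Frame) (w : ℂ) : F.toGlobal (F.toLocal w) = w := by
  rcases F with ⟨u, hu, m⟩
  cases m <;> simp [toLocal, toGlobal, mul_div_cancel₀, hu]

end Frame

/-! ### Teams -/

/-- A team of `n ≥ 2` robots together with its capabilities: whether its movements are rigid, and
how far its local coordinate systems agree, given as the set of joint assignments of coordinate
systems that the adversary may choose. Full disorientation is the set of all assignments,
chirality the set of assignments with a common value of `mirror`, a common coordinate system the
set of constant assignments, and so on. The global coordinate system is unknown to the robots
(`global_unknown`), and the robots are identical (`identical`). -/
structure Team where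
  n : ℕ
  two_le : 2 ≤ n
  rigid : Bool
  frames : Set (Fin n → Frame)
  frames_nonempty : frames.Nonempty
  global_unknown : ∀ F ∈ frames, ∀ (g : Frame) (F' : Fin n → Frame),
    (∀ r v, (F' r).toGlobal v = g.toGlobal ((F r).toGlobal v)) → F' ∈ frames
  identical : ∀ F ∈ frames, ∀ π : Equiv.Perm (Fin n), (fun r => F (π r)) ∈ frames

/-! ### Models and algorithms -/

/-- The four computational models. -/
inductive Model where
  | LUMI
  | FCOM
  | FSTA
  | OBLOT

/-- Does a robot see its own lights? -/
def Model.seesOwn : Model → Bool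
  | .LUMI => true
  | .FCOM => false
  | .FSTA => true
  | .OBLOT => false

/-- Does a robot see the lights of the other robots? -/
def Model.seesOthers : Model → Bool
  | .LUMI => true
  | .FCOM => true
  | .FSTA => false
  | .OBLOT => false

/-- A deterministic algorithm, the same for all robots. A robot has finitely many lights, indexed
by `Idx`, light `i` having the finite set `Color i` of colors, with initial color `off i`. The
input of `compute` is what the robot sees of its own lights (`none` if nothing) and the multiset
of the positions of the other robots in local coordinates, each with what is seen of the lights
of that robot (`none` if nothing). The output says for every light whether it is left as it is
(`none`) or set to a color (`some c`), and gives the destination in local coordinates. -/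
structure Algorithm where
  Idx : Type
  finite_idx : Finite Idx
  Color : Idx → Type
  finite_color : ∀ i, Finite (Color i)
  off : ∀ i, Color i
  compute : Option (∀ i, Color i) → Multiset (ℂ × Option (∀ i, Color i)) →
    (∀ i, Option (Color i)) × ℂ

/-- The joint values of all lights of one robot. -/
abbrev Algorithm.Light (A : Algorithm) : Type := ∀ i, A.Color i

/-- Positions (in global coordinates) and lights of `n` robots. -/
structure Config (A : Algorithm) (n : ℕ) where
  pos : Fin n → ℂ
  light : Fin n → A.Light

/-- What robot `r` sees of the other robots, with strong multiplicity detection. -/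
def snapshot (M : Model) {A : Algorithm} {n : ℕ} (F : Fin n → Frame) (K : Config A n)
    (r : Fin n) : Multiset (ℂ × Option A.Light) :=
  (Finset.univ.erase r).val.map fun s =>
    ((F r).toLocal (K.pos s - K.pos r), if M.seesOthers then some (K.light s) else none)

/-- The result of the Compute phase of robot `r`. -/
def output (M : Model) {A : Algorithm} {n : ℕ} (F : Fin n → Frame) (K : Config A n)
    (r : Fin n) : (∀ i, Option (A.Color i)) × ℂ :=
  A.compute (if M.seesOwn then some (K.light r) else none) (snapshot M F K r)

/-- `Moves rigid δ x d y`: a robot at `x` with destination `d` may end its Move phase at `y`.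
If movements are not rigid, it may be stopped on its way, but it reaches `d` if `d` is at
distance at most `δ`, and otherwise it moves at least `δ` towards `d`. -/
def Moves (rigid : Bool) (δ : ℝ) (x d y : ℂ) : Prop :=
  if rigid then y = d else y ∈ segment ℝ x d ∧ min δ (dist x d) ≤ dist x y

/-- One round, in which the robots of the set `e` are active. -/
def Round (M : Model) {A : Algorithm} {n : ℕ} (rigid : Bool) (δ : ℝ) (F : Fin n → Frame)
    (e : Set (Fin n)) (K K' : Config A n) : Prop :=
  ∀ r,
    (r ∉ e → K'.pos r = K.pos r ∧ K'.light r = K.light r) ∧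
    (r ∈ e →
      Moves rigid δ (K.pos r) (K.pos r + (F r).toGlobal (output M F K r).2) (K'.pos r) ∧
      ∀ i, K'.light r i = ((output M F K r).1 i).getD (K.light r i))

/-! ### Schedulers -/

/-- `e i` is the set of robots that are active in round `i`; the first round is round `0`. -/
abbrev ActivationSeq (n : ℕ) : Type := ℕ → Set (Fin n)

def Fair {n : ℕ} (e : ActivationSeq n) : Prop :=
  (∀ r, ∃ i, r ∈ e i) ∧ ∀ r i, r ∈ e i → ∃ j, i < j ∧ r ∈ e j

/-- A scheduler is given by its activation sequences. -/
abbrev Scheduler : Type := (n : ℕ) → Set (ActivationSeq n)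

/-- The semi-synchronous scheduler. -/
def SSYNCH : Scheduler := fun _ => {e | Fair e ∧ ∀ i, (e i).Nonempty}

/-- The restricted-repetition scheduler. -/
def RSYNCH : Scheduler := fun n =>
  {e | e ∈ SSYNCH n ∧
    ((∀ i, e i = Set.univ) ∨
      ∃ p : ℕ, (∀ i, i < p → e i = Set.univ) ∧
        ∀ i, p ≤ i → (e i).Nonempty ∧ e i ≠ Set.univ ∧ e i ∩ e (i + 1) = ∅)}

/-! ### Problems and computational power -/

/-- A problem for `n` robots: the valid initial placements, and the valid sequences of placements
over the rounds. Rounds in which no robot changes its place are immaterial: validity is not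
affected by repeating placements finitely often (`σ ∘ f` is `σ` with each entry repeated a finite
positive number of times), nor by undoing such repetitions. -/
structure Problem (n : ℕ) where
  init : Set (Fin n → ℂ)
  valid : Set (ℕ → Fin n → ℂ)
  stutter : ∀ (σ : ℕ → Fin n → ℂ) (f : ℕ → ℕ), Monotone f → Function.Surjective f →
    (σ ∘ f ∈ valid ↔ σ ∈ valid)

/-- `A` solves `P` with the team `R` in the model `M` under the scheduler `S`: whatever the
admissible coordinate systems, the constant `δ` of non-rigid movements, the activation sequence
and the stops of the moves are, every execution from a valid initial placement with all lights
off is valid. -/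
def Solves (M : Model) (S : Scheduler) (R : Team) (A : Algorithm) (P : Problem R.n) : Prop :=
  ∀ F ∈ R.frames, ∀ δ : ℝ, 0 < δ → ∀ e ∈ S R.n, ∀ K : ℕ → Config A R.n,
    (K 0).pos ∈ P.init → (∀ r, (K 0).light r = A.off) →
    (∀ t, Round M R.rigid δ F (e t) (K t) (K (t + 1))) →
    (fun t => (K t).pos) ∈ P.valid

/-- The set of problems solvable by the team `R` in the model `M` under the scheduler `S`. -/
def Task (M : Model) (S : Scheduler) (R : Team) : Set (Problem R.n) :=
  {P | ∃ A : Algorithm, Solves M S R A P}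

/-- `M₁` under `S₁` is computationally not less powerful than `M₂` under `S₂`. -/
def NotLessPowerful (M₁ : Model) (S₁ : Scheduler) (M₂ : Model) (S₂ : Scheduler) : Prop :=
  ∀ R : Team, Task M₂ S₂ R ⊆ Task M₁ S₁ R

/-- `M₁` under `S₁` is computationally more powerful than `M₂` under `S₂`. -/
def MorePowerful (M₁ : Model) (S₁ : Scheduler) (M₂ : Model) (S₂ : Scheduler) : Prop :=
  NotLessPowerful M₁ S₁ M₂ S₂ ∧ ∃ R : Team, (Task M₁ S₁ R \ Task M₂ S₂ R).Nonempty

/-- `M₁` under `S₁` and `M₂` under `S₂` are computationally equivalent. -/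
def Equivalent (M₁ : Model) (S₁ : Scheduler) (M₂ : Model) (S₂ : Scheduler) : Prop :=
  NotLessPowerful M₁ S₁ M₂ S₂ ∧ NotLessPowerful M₂ S₂ M₁ S₁

end

end LCMRobots

/-! Apart from the inclusions that merely forget lights or activation sequences, two simulations and
two separating problems are needed. `LUMI` under `SSYNCH` can enforce restricted repetition
(`lumi_SSYNCH_notLessPowerful_lumi_RSYNCH`). While all rounds are full, everybody acts. The first
round that is not full splits the team into robots ahead and robots behind, which the clocks record
for ever. From then on the two teams act alternately, controlled by parities of action counts, and a
robot without the turn does nothing. The rounds in which somebody acts form a sequence in `RSYNCH`,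
and empty rounds do not matter by stuttering invariance. `FCOM` under `RSYNCH` can simulate `LUMI`
under `SSYNCH` (`fcom_RSYNCH_notLessPowerful_lumi_SSYNCH`). The missing ability is to see one's own
lights. States are coded in a cyclic group and every robot publishes the sum of the states of the
others, so that a robot reads off its own state from the light of any other one. Sums become stale
when somebody acts, hence they are renewed in epochs. Restricted repetition guarantees that an
active robot sees a robot which shows that the old epoch is over: in the partial phase, one that was
active in the previous round and is idle now. `FSTA` exceeds `OBLOT` because gathered oblivious
robots with a common frame, always active together, have a constant view and move never or for ever,
whereas one light suffices to move exactly once. `FCOM` exceeds `FSTA` because of a relay: robot `0`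
has to move according to the starting place of robot `1`, but it may first be activated after robot
`1` has left that place. Only a visible light of robot `1` can pass on the information. The relay is
solved in `LUMI` and the solution is transferred by the simulations. -/

namespace LCMRobots

/-! ### Basic facts on rounds -/

theorem Frame.toGlobal_zero (F : Frame) : F.toGlobal 0 = 0 := by
  simp [Frame.toGlobal]

theorem Moves.eq_of_stay {rigid : Bool} {δ : ℝ} {x y : ℂ} (h : Moves rigid δ x x y) : y = x := by
  unfold Moves at h
  split_ifs at h
  · exact h
  · simpa using h.1

theorem Config.ext' {A : Algorithm} {n : ℕ} {K K' : Config A n} (hp : K.pos = K'.pos)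
    (hl : K.light = K'.light) : K = K' := by
  cases K; cases K'; simp_all

theorem Round.eq_of_empty {M : Model} {A : Algorithm} {n : ℕ} {rigid : Bool} {δ : ℝ}
    {F : Fin n → Frame} {K K' : Config A n} (h : Round M rigid δ F ∅ K K') : K' = K :=
  Config.ext' (funext fun r => ((h r).1 (by simp)).1) (funext fun r => ((h r).1 (by simp)).2)

theorem Fair.exists_ge {n : ℕ} {e : ActivationSeq n} (h : Fair e) (r : Fin n) (t : ℕ) :
    ∃ s, t ≤ s ∧ r ∈ e s := by
  induction t with
  | zero => obtain ⟨i, hi⟩ := h.1 r; exact ⟨i, by simp, hi⟩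
  | succ t ih =>
    obtain ⟨s, hs, hr⟩ := ih
    obtain ⟨j, hj, hr'⟩ := h.2 r s hr
    exact ⟨j, by omega, hr'⟩

theorem Fair.of_infinite {n : ℕ} {e : ActivationSeq n} (h : ∀ r, {t | r ∈ e t}.Infinite) :
    Fair e := by
  refine ⟨fun r => (h r).nonempty, fun r i _ => ?_⟩
  obtain ⟨j, hj, hij⟩ := (h r).exists_gt i
  exact ⟨j, hij, hj⟩

theorem RSYNCH.inter_eq_empty {n : ℕ} {e : ActivationSeq n} (h : e ∈ RSYNCH n) {t : ℕ}
    (ht : e t ≠ Set.univ) : e t ∩ e (t + 1) = ∅ := by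
  rcases h.2 with h | ⟨p, h1, h2⟩
  · exact absurd (h t) ht
  · refine (h2 t ?_).2.2
    by_contra hlt
    exact ht (h1 t (by omega))

/-! ### Simulations

The rounds `g t` of a simulated execution may be empty; removing the empty ones does not affect
the validity of the sequence of placements. -/

/-- The rounds in which somebody is active, in their order. -/
noncomputable def compress {n : ℕ} (g : ℕ → Set (Fin n)) : ActivationSeq n :=
  fun i => g (Nat.nth (fun t => (g t).Nonempty) i)

theorem mem_compress_infinite {n : ℕ} {g : ℕ → Set (Fin n)}
    (r : Fin n) (h : {t | r ∈ g t}.Infinite) :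
    {i | r ∈ compress g i}.Infinite := by
  classical
  have hinf : {t | (g t).Nonempty}.Infinite := h.mono fun t ht => ⟨r, ht⟩
  refine Set.infinite_of_not_bddAbove fun ⟨b, hb⟩ => ?_
  obtain ⟨t, ht, hbt⟩ := h.exists_gt (Nat.nth (fun t => (g t).Nonempty) b)
  have hpt : (g t).Nonempty := ⟨r, ht⟩
  have h1 : Nat.nth (fun t => (g t).Nonempty) (Nat.count (fun t => (g t).Nonempty) t) = t :=
    Nat.nth_count hpt
  have h2 : Nat.count (fun t => (g t).Nonempty) t ≤ b := hb (by
    change r ∈ g _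
    rw [h1]; exact ht)
  have h3 := (Nat.nth_monotone hinf) h2
  rw [h1] at h3
  omega

theorem compress_mem_SSYNCH {n : ℕ} (hn : 2 ≤ n) {g : ℕ → Set (Fin n)}
    (h : ∀ r, {t | r ∈ g t}.Infinite) : compress g ∈ SSYNCH n := by
  have hinf : {t | (g t).Nonempty}.Infinite := (h ⟨0, by omega⟩).mono fun t ht => ⟨_, ht⟩
  exact ⟨Fair.of_infinite fun r => mem_compress_infinite r (h r),
    fun i => Nat.nth_mem_of_infinite hinf i⟩

/-- Empty rounds leave the configuration unchanged, so dropping them gives a genuine execution of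
`A`, from which the given sequence of placements arises by repeating entries. -/
theorem valid_of_simulation {S : Scheduler} {R : Team} {A : Algorithm} {P : Problem R.n}
    (hA : Solves .LUMI S R A P) {F : Fin R.n → Frame} (hF : F ∈ R.frames) {δ : ℝ} (hδ : 0 < δ)
    {g : ℕ → Set (Fin R.n)} (hinf : {t | (g t).Nonempty}.Infinite) (hg : compress g ∈ S R.n)
    {L : ℕ → Config A R.n} (h0 : (L 0).pos ∈ P.init) (hoff : ∀ r, (L 0).light r = A.off)
    (hL : ∀ t, Round .LUMI R.rigid δ F (g t) (L t) (L (t + 1))) :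
    (fun t => (L t).pos) ∈ P.valid := by
  classical
  set p : ℕ → Prop := fun t => (g t).Nonempty with hp
  have hstay : ∀ t, ¬ p t → L (t + 1) = L t := fun t ht => by
    have := hL t
    rw [Set.not_nonempty_iff_eq_empty.1 ht] at this
    exact this.eq_of_empty
  -- `Nat.nth p (Nat.count p t)` is the first nonempty round not before `t`; nothing changes until
  -- then.
  have hnext : ∀ t, L t = L (Nat.nth p (Nat.count p t)) := by
    intro t
    have key : ∀ s, t ≤ s → s ≤ Nat.nth p (Nat.count p t) → L s = L t := by
      intro s hs
      induction s, hs using Nat.le_induction with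
      | base => intro _; rfl
      | succ s hs ih =>
        intro hle
        rw [hstay s ?_, ih (by omega)]
        intro hps
        have h1 : Nat.count p s < Nat.count p t := by
          by_contra hc
          have := Nat.nth_monotone hinf (not_lt.1 hc)
          rw [Nat.nth_count hps] at this
          omega
        exact absurd (Nat.count_monotone p hs) (by omega)
    exact (key _ (Nat.le_nth_count hinf t) le_rfl).symm
  have hmain := hA F hF δ hδ _ hg (fun i => L (Nat.nth p i))
  have h00 : L (Nat.nth p 0) = L 0 := by
    have := hnext 0
    rw [Nat.count_zero] at this
    exact this.symm
  have hv := hmain (by simpa only [h00] using h0) (by simpa only [h00] using hoff) (by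
    intro i
    have h1 := hL (Nat.nth p i)
    rw [hnext (Nat.nth p i + 1), Nat.count_succ, Nat.count_nth_of_infinite hinf,
      if_pos (Nat.nth_mem_of_infinite hinf i)] at h1
    exact h1)
  rw [← P.stutter _ (Nat.count p) (Nat.count_monotone p)
    (fun i => ⟨Nat.nth p i, Nat.count_nth_of_infinite hinf i⟩)] at hv
  convert hv using 1
  funext t
  exact congrArg Config.pos (hnext t)

open Classical in
/-- How often robot `r` is in the sets `g 0`, …, `g (t - 1)`. -/
noncomputable def acts {n : ℕ} (g : ℕ → Set (Fin n)) (t : ℕ) (r : Fin n) : ℕ :=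
  Nat.count (fun t => r ∈ g t) t

theorem acts_succ_of_mem {n : ℕ} {g : ℕ → Set (Fin n)} {t : ℕ} {r : Fin n} (h : r ∈ g t) :
    acts g (t + 1) r = acts g t r + 1 := by
  classical
  simp [acts, Nat.count_succ, h]

theorem acts_succ_of_notMem {n : ℕ} {g : ℕ → Set (Fin n)} {t : ℕ} {r : Fin n} (h : r ∉ g t) :
    acts g (t + 1) r = acts g t r := by
  classical
  simp [acts, Nat.count_succ, h]

/-- If the numbers of activations of the robots stay close to each other, then the activations
are distributed fairly. -/
theorem infinite_of_acts_le {n : ℕ} {g : ℕ → Set (Fin n)} (c : ℕ)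
    (h : ∀ t r s, acts g t r ≤ acts g t s + c)
    (hinf : {t | (g t).Nonempty}.Infinite) (r : Fin n) : {t | r ∈ g t}.Infinite := by
  classical
  -- Pigeonhole: infinitely many nonempty rounds, finitely many robots.
  obtain ⟨s, hs⟩ : ∃ s, {t | s ∈ g t}.Infinite := by
    by_contra hc
    push Not at hc
    refine hinf ((Set.finite_iUnion hc).subset fun t ht => ?_)
    obtain ⟨s, hs⟩ := ht
    exact Set.mem_iUnion.2 ⟨s, hs⟩
  intro hfin
  obtain ⟨b, hb⟩ := hfin.bddAbove
  have hconst : ∀ t, acts g t r ≤ b + 1 := by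
    intro t
    induction t with
    | zero => simp [acts]
    | succ t ih =>
      by_cases hr : r ∈ g t
      · have h1 : t ≤ b := hb hr
        have h2 : acts g t r ≤ t := Nat.count_le _
        rw [acts_succ_of_mem hr]
        omega
      · rwa [acts_succ_of_notMem hr]
  -- When `s` has acted `b + c + 2` times, `r` must have acted at least `b + 2` times, against the
  -- bound `b + 1`.
  have h1 := h (Nat.nth (fun t => s ∈ g t) (b + c + 2)) s r
  have h2 : acts g (Nat.nth (fun t => s ∈ g t) (b + c + 2)) s = b + c + 2 := by
    unfold acts
    convert Nat.count_nth_of_infinite hs (b + c + 2)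
  have := hconst (Nat.nth (fun t => s ∈ g t) (b + c + 2))
  omega

/-! ### Inclusions that only forget information -/

theorem notLessPowerful_of_subset {M : Model} {S S' : Scheduler} (h : ∀ n, S n ⊆ S' n) :
    NotLessPowerful M S M S' := by
  rintro R P ⟨A, hA⟩
  exact ⟨A, fun F hF δ hδ e he => hA F hF δ hδ e (h _ he)⟩

/-- The algorithm `A` as it runs in the model `M`, in a model where more is seen. -/
def Algorithm.restrict (A : Algorithm) (M : Model) : Algorithm where
  Idx := A.Idx
  finite_idx := A.finite_idx
  Color := A.Color
  finite_color := A.finite_color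
  off := A.off
  compute own V := A.compute (if M.seesOwn then own else none)
    (V.map fun v => (v.1, if M.seesOthers then v.2 else none))

theorem output_restrict {M M' : Model} (ho : M.seesOwn → M'.seesOwn)
    (hs : M.seesOthers → M'.seesOthers) {A : Algorithm} {n : ℕ} (F : Fin n → Frame)
    (K : Config A n) (r : Fin n) :
    output M' (A := A.restrict M) F ⟨K.pos, K.light⟩ r = output M F K r := by
  cases M <;> cases M' <;>
    simp_all [output, snapshot, Algorithm.restrict, Model.seesOwn, Model.seesOthers,
      Multiset.map_map]

theorem notLessPowerful_of_sees {M M' : Model} (S : Scheduler) (ho : M.seesOwn → M'.seesOwn)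
    (hs : M.seesOthers → M'.seesOthers) : NotLessPowerful M' S M S := by
  rintro R P ⟨A, hA⟩
  refine ⟨A.restrict M, fun F hF δ hδ e he K h0 hoff hK => ?_⟩
  refine hA F hF δ hδ e he (fun t => ⟨(K t).pos, (K t).light⟩) h0 hoff fun t r => ?_
  have := hK t r
  have ho := output_restrict ho hs F (A := A) ⟨(K t).pos, (K t).light⟩ r
  change output M' F (K t) r = _ at ho
  rw [ho] at this
  exact this

/-! ### `LUMI` robots that enforce restricted repetition

Every robot has a clock and a parity bit. As long as all clocks agree, every active robot acts
and advances its clock. The first time when not all robots are active, the robots split into those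
that are ahead and those that are behind. From then on the clocks are frozen, and the two teams
act in turns, every robot acting once in each turn of its team. The parity bit counts the actions
of a robot modulo 2. -/

section Turns

variable {n : ℕ}

/-- May robot `r` act, if the robots have clocks `c` and parity bits `b`? -/
def Turn (c : Fin n → ZMod 3) (b : Fin n → ZMod 2) (r : Fin n) : Prop :=
  (∀ s, s ≠ r → c s = c r) ∨
  ((∃ s, s ≠ r ∧ c s = c r + 1) ∧ ∀ s, s ≠ r → c s = c r + 1 → b s ≠ b r) ∨
  ((∃ s, s ≠ r ∧ c s = c r - 1) ∧ ∀ s, s ≠ r → c s = c r - 1 → b s = b r)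

/-- The situation after the split: the team behind has clocks `k`, the team ahead has clocks
`k + 1`, and robot `r` has acted `x r` times. -/
structure Balanced (k : ZMod 3) (c : Fin n → ZMod 3) (x : Fin n → ℕ) : Prop where
  clock : ∀ r, c r = k ∨ c r = k + 1
  behind : ∃ r, c r = k
  ahead : ∃ r, c r = k + 1
  le : ∀ a b, c a = k + 1 → c b = k → x b ≤ x a ∧ x a ≤ x b + 1
  const : (∀ a a', c a = k + 1 → c a' = k + 1 → x a = x a') ∨
    ∀ b b', c b = k → c b' = k → x b = x b'

/-- This is why one bit per robot is enough: the counts to be compared differ by 0 or 1, in a known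
direction. -/
theorem natCast_zmod_two_eq {x y : ℕ} (h : x ≤ y) (h' : y ≤ x + 1) :
    (x : ZMod 2) = (y : ZMod 2) ↔ x = y := by
  rw [ZMod.natCast_eq_natCast_iff']
  omega

/-- Modulo 3 the successor and the predecessor of a clock value differ, so a robot can tell whether
it is ahead or behind. Modulo 2 it could not. -/
theorem zmod_three_facts (k : ZMod 3) :
    k + 1 ≠ k ∧ k + 1 + 1 ≠ k ∧ k + 1 + 1 ≠ k + 1 ∧ k - 1 ≠ k ∧ k - 1 ≠ k + 1 ∧ k + 1 - 1 = k := by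
  revert k; decide

/-- Turns what robots can see into a statement on counts: by `le`, equality of parities across the
two teams is equality of counts. The clause of equal clocks is void since both teams are nonempty.
-/
theorem Balanced.turn_iff {k : ZMod 3} {c : Fin n → ZMod 3} {x : Fin n → ℕ}
    (h : Balanced k c x) (r : Fin n) :
    Turn c (fun r => (x r : ZMod 2)) r ↔
      (c r = k ∧ ∀ a, c a = k + 1 → x a = x r + 1) ∨ (c r = k + 1 ∧ ∀ b, c b = k → x b = x r) := by
  obtain ⟨z1, z2, z3, z4, z5, z6⟩ := zmod_three_facts k
  obtain ⟨b₀, hb₀⟩ := h.behind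
  obtain ⟨a₀, ha₀⟩ := h.ahead
  have hpar : ∀ a b, c a = k + 1 → c b = k → ((x b : ZMod 2) = x a ↔ x b = x a) :=
    fun a b ha hb => natCast_zmod_two_eq (h.le a b ha hb).1 (h.le a b ha hb).2
  rcases h.clock r with hr | hr
  · have hne : ∀ s, c s = k + 1 → s ≠ r := by
      rintro s hs rfl; exact z1 (hs.symm.trans hr)
    constructor
    · rintro (h1 | ⟨-, h1⟩ | ⟨⟨s, -, h1⟩, -⟩)
      · exact absurd (h1 a₀ (hne _ ha₀)) (by rw [ha₀, hr]; exact z1)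
      · refine Or.inl ⟨hr, fun a ha => ?_⟩
        have h2 := h1 a (hne a ha) (by rw [ha, hr])
        have h3 : x r ≠ x a := fun h3 => h2 ((hpar a r ha hr).2 h3).symm
        have := h.le a r ha hr
        omega
      · rcases h.clock s with hs | hs <;> rw [hs, hr] at h1
        · exact absurd h1.symm z4
        · exact absurd h1.symm z5
    · rintro (⟨-, h1⟩ | ⟨h1, -⟩)
      · refine Or.inr (Or.inl ⟨⟨a₀, hne _ ha₀, by rw [ha₀, hr]⟩, fun s hsr hs => ?_⟩)
        rw [hr] at hs
        have h2 := h1 s hs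
        intro h3
        have := (hpar s r hs hr).1 h3.symm
        omega
      · exact absurd (h1.symm.trans hr) z1
  · have hne : ∀ s, c s = k → s ≠ r := by
      rintro s hs rfl; exact z1 (hr.symm.trans hs)
    constructor
    · rintro (h1 | ⟨⟨s, -, h1⟩, -⟩ | ⟨-, h1⟩)
      · exact absurd (h1 b₀ (hne _ hb₀)) (by rw [hb₀, hr]; exact z1.symm)
      · rcases h.clock s with hs | hs <;> rw [hs, hr] at h1
        · exact absurd h1.symm z2
        · exact absurd h1.symm z3
      · refine Or.inr ⟨hr, fun b hb => ?_⟩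
        exact (hpar r b hr hb).1 (h1 b (hne b hb) (by rw [hb, hr, z6]))
    · rintro (⟨h1, -⟩ | ⟨-, h1⟩)
      · exact absurd (hr.symm.trans h1) z1
      · refine Or.inr (Or.inr ⟨⟨b₀, hne _ hb₀, by rw [hb₀, hr, z6]⟩, fun s hsr hs => ?_⟩)
        rw [hr, z6] at hs
        exact (hpar r s hr hs).2 (h1 s hs)

/-- The two teams never act in the same round: a robot behind requires all robots ahead to have one
action more, a robot ahead requires all robots behind to have equally many. Hence if somebody acts,
the other team waits with a constant count, which preserves `const`. -/
theorem Balanced.step {k : ZMod 3} {c : Fin n → ZMod 3} {x x' : Fin n → ℕ}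
    (h : Balanced k c x)
    (hx : ∀ r, x' r = x r ∨ (x' r = x r + 1 ∧ Turn c (fun r => (x r : ZMod 2)) r)) :
    Balanced k c x' := by
  simp only [h.turn_iff] at hx
  have z1 := (zmod_three_facts k).1
  have hA : ∀ a, c a = k + 1 → x' a = x a ∨ (x' a = x a + 1 ∧ ∀ b, c b = k → x b = x a) := by
    intro a ha
    rcases hx a with h1 | ⟨h1, ⟨h2, -⟩ | ⟨-, h2⟩⟩
    · exact Or.inl h1
    · exact absurd (ha.symm.trans h2) z1
    · exact Or.inr ⟨h1, h2⟩
  have hB : ∀ b, c b = k → x' b = x b ∨ (x' b = x b + 1 ∧ ∀ a, c a = k + 1 → x a = x b + 1) := by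
    intro b hb
    rcases hx b with h1 | ⟨h1, ⟨-, h2⟩ | ⟨h2, -⟩⟩
    · exact Or.inl h1
    · exact Or.inr ⟨h1, h2⟩
    · exact absurd (h2.symm.trans hb) z1
  refine ⟨h.clock, h.behind, h.ahead, fun a b ha hb => ?_, ?_⟩
  · have h0 := h.le a b ha hb
    rcases hA a ha with h1 | ⟨h1, h1'⟩ <;> rcases hB b hb with h2 | ⟨h2, h2'⟩
    · omega
    · have := h2' a ha; omega
    · have := h1' b hb; omega
    · have := h1' b hb; have := h2' a ha; omega
  · by_cases hex : ∃ b, c b = k ∧ x' b = x b + 1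
    · obtain ⟨b, hb, hb'⟩ := hex
      have h2 : ∀ a, c a = k + 1 → x a = x b + 1 := by
        rcases hB b hb with h1 | ⟨-, h1⟩
        · omega
        · exact h1
      refine Or.inl fun a a' ha ha' => ?_
      have key : ∀ a, c a = k + 1 → x' a = x a := by
        intro a ha
        rcases hA a ha with h1 | ⟨-, h1⟩
        · exact h1
        · have := h1 b hb; have := h2 a ha; omega
      rw [key a ha, key a' ha', h2 a ha, h2 a' ha']
    · by_cases hex' : ∃ a, c a = k + 1 ∧ x' a = x a + 1
      · obtain ⟨a, ha, ha'⟩ := hex'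
        have h2 : ∀ b, c b = k → x b = x a := by
          rcases hA a ha with h1 | ⟨-, h1⟩
          · omega
          · exact h1
        refine Or.inr fun b b' hb hb' => ?_
        have key : ∀ b, c b = k → x' b = x b := by
          intro b hb
          rcases hB b hb with h1 | ⟨h1, -⟩
          · exact h1
          · exact absurd ⟨b, hb, h1⟩ hex
        rw [key b hb, key b' hb', h2 b hb, h2 b' hb']
      · have keyA : ∀ a, c a = k + 1 → x' a = x a := by
          intro a ha
          rcases hA a ha with h1 | ⟨h1, -⟩
          · exact h1
          · exact absurd ⟨a, ha, h1⟩ hex'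
        have keyB : ∀ b, c b = k → x' b = x b := by
          intro b hb
          rcases hB b hb with h1 | ⟨h1, -⟩
          · exact h1
          · exact absurd ⟨b, hb, h1⟩ hex
        rcases h.const with h1 | h1
        · exact Or.inl fun a a' ha ha' => by rw [keyA a ha, keyA a' ha', h1 a a' ha ha']
        · exact Or.inr fun b b' hb hb' => by rw [keyB b hb, keyB b' hb', h1 b b' hb hb']

/-- Take a team with constant count. Either some robot of the other team still has to complete its
turn, and it may act, or all have done so, and the constant team may act. -/
theorem Balanced.exists_turn {k : ZMod 3} {c : Fin n → ZMod 3} {x : Fin n → ℕ}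
    (h : Balanced k c x) : ∃ r, Turn c (fun r => (x r : ZMod 2)) r := by
  simp only [h.turn_iff]
  obtain ⟨b₀, hb₀⟩ := h.behind
  obtain ⟨a₀, ha₀⟩ := h.ahead
  rcases h.const with h1 | h1
  · by_cases hex : ∃ b, c b = k ∧ x a₀ = x b + 1
    · obtain ⟨b, hb, hx⟩ := hex
      exact ⟨b, Or.inl ⟨hb, fun a ha => (h1 a a₀ ha ha₀).trans hx⟩⟩
    · refine ⟨a₀, Or.inr ⟨ha₀, fun b hb => ?_⟩⟩
      have := h.le a₀ b ha₀ hb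
      have : x a₀ ≠ x b + 1 := fun h2 => hex ⟨b, hb, h2⟩
      omega
  · by_cases hex : ∃ a, c a = k + 1 ∧ x b₀ = x a
    · obtain ⟨a, ha, hx⟩ := hex
      exact ⟨a, Or.inr ⟨ha, fun b hb => (h1 b b₀ hb hb₀).trans hx⟩⟩
    · refine ⟨b₀, Or.inl ⟨hb₀, fun a ha => ?_⟩⟩
      have := h.le a b₀ ha hb₀
      have : x b₀ ≠ x a := fun h2 => hex ⟨a, ha, h2⟩
      omega

/-- Robots of opposite teams never have the turn simultaneously, so no round after the split is
full. -/
theorem Balanced.exists_not_turn {k : ZMod 3} {c : Fin n → ZMod 3} {x : Fin n → ℕ}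
    (h : Balanced k c x) : ∃ r, ¬ Turn c (fun r => (x r : ZMod 2)) r := by
  by_contra hc
  push Not at hc
  simp only [h.turn_iff] at hc
  have z1 := (zmod_three_facts k).1
  obtain ⟨b, hb⟩ := h.behind
  obtain ⟨a, ha⟩ := h.ahead
  rcases hc b with ⟨-, h1⟩ | ⟨h1, -⟩
  · rcases hc a with ⟨h2, -⟩ | ⟨-, h2⟩
    · exact z1 (ha.symm.trans h2)
    · have := h1 a ha; have := h2 b hb; omega
  · exact z1 (h1.symm.trans hb)

/-- To act again, a robot needs an action of the other team in between, but the other team could not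
act in the same round. This yields the disjointness of consecutive rounds in `RSYNCH`. -/
theorem Balanced.not_turn_after {k : ZMod 3} {c : Fin n → ZMod 3} {x x' : Fin n → ℕ}
    (h : Balanced k c x)
    (hx : ∀ r, x' r = x r ∨ (x' r = x r + 1 ∧ Turn c (fun r => (x r : ZMod 2)) r))
    {r : Fin n} (hr : Turn c (fun r => (x r : ZMod 2)) r) (hxr : x' r = x r + 1) :
    ¬ Turn c (fun r => (x' r : ZMod 2)) r := by
  rw [(h.step hx).turn_iff]
  simp only [h.turn_iff] at hx hr
  have z1 := (zmod_three_facts k).1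
  obtain ⟨b, hb⟩ := h.behind
  obtain ⟨a, ha⟩ := h.ahead
  rintro (⟨h1, h2⟩ | ⟨h1, h2⟩)
  · rcases hr with ⟨-, h3⟩ | ⟨h3, -⟩
    · have e1 := h2 a ha
      have e2 := h3 a ha
      rcases hx a with e3 | ⟨-, ⟨e3, -⟩ | ⟨-, e3⟩⟩
      · omega
      · exact z1 (ha.symm.trans e3)
      · have := e3 r h1; omega
    · exact z1 (h3.symm.trans h1)
  · rcases hr with ⟨h3, -⟩ | ⟨-, h3⟩
    · exact z1 (h1.symm.trans h3)
    · have e1 := h2 b hb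
      have e2 := h3 b hb
      rcases hx b with e3 | ⟨-, ⟨-, e3⟩ | ⟨e3, -⟩⟩
      · omega
      · have := e3 r h1; omega
      · exact z1 (e3.symm.trans hb)

theorem turn_of_const {c : Fin n → ZMod 3} (b : Fin n → ZMod 2) (hc : ∀ r s, c r = c s)
    (r : Fin n) : Turn c b r := Or.inl fun s _ => hc s r

/-- The clocks and parity bits of robots that act whenever they are active and may act. -/
structure TurnRun (e : ActivationSeq n) (c : ℕ → Fin n → ZMod 3) (b : ℕ → Fin n → ZMod 2)
    (g : ℕ → Set (Fin n)) : Prop where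
  clock_zero : ∀ r, c 0 r = 0
  parity_zero : ∀ r, b 0 r = 0
  mem_iff : ∀ t r, r ∈ g t ↔ r ∈ e t ∧ Turn (c t) (b t) r
  clock_inc : ∀ t r, r ∈ g t → (∀ s, s ≠ r → c t s = c t r) → c (t + 1) r = c t r + 1
  clock_eq : ∀ t r, ¬ (r ∈ g t ∧ ∀ s, s ≠ r → c t s = c t r) → c (t + 1) r = c t r
  parity_inc : ∀ t r, r ∈ g t → b (t + 1) r = b t r + 1
  parity_eq : ∀ t r, r ∉ g t → b (t + 1) r = b t r

/-! ### Acting in turns yields restricted repetition. -/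

namespace TurnRun

variable {e : ActivationSeq n} {c : ℕ → Fin n → ZMod 3} {b : ℕ → Fin n → ZMod 2}
  {g : ℕ → Set (Fin n)}

theorem parity (H : TurnRun e c b g) (t : ℕ) : b t = fun r => (acts g t r : ZMod 2) := by
  induction t with
  | zero => funext r; simp [H.parity_zero, acts]
  | succ t ih =>
    funext r
    by_cases hr : r ∈ g t
    · rw [H.parity_inc t r hr, acts_succ_of_mem hr, ih]; push_cast; rfl
    · rw [H.parity_eq t r hr, acts_succ_of_notMem hr, ih]

theorem acts_step (H : TurnRun e c b g) (t : ℕ) (r : Fin n) :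
    acts g (t + 1) r = acts g t r ∨
      (acts g (t + 1) r = acts g t r + 1 ∧ Turn (c t) (fun r => (acts g t r : ZMod 2)) r) := by
  by_cases hr : r ∈ g t
  · right
    rw [← H.parity t]
    exact ⟨acts_succ_of_mem hr, ((H.mem_iff t r).1 hr).2⟩
  · exact Or.inl (acts_succ_of_notMem hr)

theorem full (H : TurnRun e c b g) {t : ℕ} (h : ∀ i, i < t → e i = Set.univ) :
    (∀ r s, c t r = c t s) ∧ ∀ r s, acts g t r = acts g t s := by
  induction t with
  | zero => simp [H.clock_zero, acts]
  | succ t ih =>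
    obtain ⟨h1, h2⟩ := ih fun i hi => h i (by omega)
    have hg : ∀ r, r ∈ g t := fun r => by
      rw [H.mem_iff, h t (by omega)]
      exact ⟨trivial, turn_of_const _ h1 r⟩
    constructor
    · intro r s
      rw [H.clock_inc t r (hg r) fun s _ => h1 s r, H.clock_inc t s (hg s) fun r _ => h1 r s,
        h1 r s]
    · intro r s
      rw [acts_succ_of_mem (hg r), acts_succ_of_mem (hg s), h2 r s]

theorem g_eq_of_full (H : TurnRun e c b g) {t : ℕ} (h : ∀ i, i < t → e i = Set.univ) :
    g t = e t := by
  ext r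
  rw [H.mem_iff]
  exact and_iff_left (turn_of_const _ (H.full h).1 r)

/-- Up to round `p` all robots are alike. The robots active in round `p` gain one clock tick and one
action over the others and thereby become the team ahead. -/
theorem split (H : TurnRun e c b g) (he : ∀ t, (e t).Nonempty) {p : ℕ}
    (h : ∀ i, i < p → e i = Set.univ) (hp : e p ≠ Set.univ) :
    ∃ k, Balanced k (c (p + 1)) (acts g (p + 1)) ∧
      ∀ r, c (p + 1) r = k + 1 ↔ r ∈ e p := by
  obtain ⟨h1, h2⟩ := H.full h
  have hg := H.g_eq_of_full h
  obtain ⟨r₁, hr₁⟩ := he p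
  obtain ⟨r₀, hr₀⟩ := (Set.ne_univ_iff_exists_notMem _).1 hp
  have z1 := (zmod_three_facts (c p r₀)).1
  have hin : ∀ r, r ∈ e p → c (p + 1) r = c p r₀ + 1 ∧ acts g (p + 1) r = acts g p r₀ + 1 := by
    intro r hr
    rw [← hg] at hr
    rw [H.clock_inc p r hr fun s _ => h1 s r, acts_succ_of_mem hr, h1 r r₀, h2 r r₀]
    exact ⟨rfl, rfl⟩
  have hout : ∀ r, r ∉ e p → c (p + 1) r = c p r₀ ∧ acts g (p + 1) r = acts g p r₀ := by
    intro r hr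
    rw [← hg] at hr
    rw [H.clock_eq p r fun h => hr h.1, acts_succ_of_notMem hr, h1 r r₀, h2 r r₀]
    exact ⟨rfl, rfl⟩
  have hiff : ∀ r, c (p + 1) r = c p r₀ + 1 ↔ r ∈ e p := by
    intro r
    refine ⟨fun h => ?_, fun h => (hin r h).1⟩
    by_contra hr
    exact z1 (h.symm.trans (hout r hr).1)
  have hiff' : ∀ r, c (p + 1) r = c p r₀ ↔ r ∉ e p := by
    intro r
    refine ⟨fun h hr => z1 ((hin r hr).1.symm.trans h), fun h => (hout r h).1⟩
  refine ⟨c p r₀, ⟨fun r => ?_, ⟨r₀, (hiff' _).2 hr₀⟩, ⟨r₁, (hiff _).2 hr₁⟩, ?_, ?_⟩, hiff⟩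
  · by_cases hr : r ∈ e p
    · exact Or.inr (hin r hr).1
    · exact Or.inl (hout r hr).1
  · intro a b ha hb
    rw [(hin a ((hiff a).1 ha)).2, (hout b ((hiff' b).1 hb)).2]
    omega
  · exact Or.inl fun a a' ha ha' => by
      rw [(hin a ((hiff a).1 ha)).2, (hin a' ((hiff a').1 ha')).2]

theorem clock_eq_of_balanced (H : TurnRun e c b g) {k : ZMod 3} {t : ℕ} {x : Fin n → ℕ}
    (h : Balanced k (c t) x) : c (t + 1) = c t := by
  funext r
  refine H.clock_eq t r fun ⟨_, hall⟩ => ?_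
  have z1 := (zmod_three_facts k).1
  obtain ⟨b, hb⟩ := h.behind
  obtain ⟨a, ha⟩ := h.ahead
  have hall' : ∀ s, c t s = c t r := fun s => by
    by_cases hs : s = r
    · rw [hs]
    · exact hall s hs
  exact z1 (ha.symm.trans ((hall' a).trans ((hall' b).symm.trans hb)))

theorem balanced (H : TurnRun e c b g) (he : ∀ t, (e t).Nonempty) {p : ℕ}
    (h : ∀ i, i < p → e i = Set.univ) (hp : e p ≠ Set.univ) :
    ∃ k, (∀ r, c (p + 1) r = k + 1 ↔ r ∈ e p) ∧
      ∀ t, p < t → Balanced k (c t) (acts g t) := by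
  obtain ⟨k, hk, hk'⟩ := H.split he h hp
  refine ⟨k, hk', fun t ht => ?_⟩
  induction t, ht using Nat.le_induction with
  | base => exact hk
  | succ t ht ih =>
    rw [H.clock_eq_of_balanced ih]
    exact ih.step (H.acts_step t)

theorem not_turn_after (H : TurnRun e c b g) (he : ∀ t, (e t).Nonempty) {p : ℕ}
    (h : ∀ i, i < p → e i = Set.univ) (hp : e p ≠ Set.univ) {t : ℕ} (ht : p ≤ t) {r : Fin n}
    (hr : r ∈ g t) : ¬ Turn (c (t + 1)) (b (t + 1)) r := by
  obtain ⟨k, hk, hbal⟩ := H.balanced he h hp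
  rcases ht.eq_or_lt with rfl | ht
  · have hb := hbal (p + 1) (by omega)
    obtain ⟨h1, h2⟩ := H.full h
    have hg := H.g_eq_of_full h
    rw [H.parity, hb.turn_iff]
    have z1 := (zmod_three_facts k).1
    have hrk : c (p + 1) r = k + 1 := (hk r).2 (hg ▸ hr)
    rintro (⟨h3, -⟩ | ⟨-, h3⟩)
    · exact z1 (hrk.symm.trans h3)
    · obtain ⟨s, hs⟩ := hb.behind
      have h4 := h3 s hs
      have hsg : s ∉ g p := by
        rw [hg, ← hk s, hs]; exact z1.symm
      rw [acts_succ_of_mem hr, acts_succ_of_notMem hsg, h2 s r] at h4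
      omega
  · have hb := hbal t ht
    rw [H.parity, H.clock_eq_of_balanced hb]
    refine hb.not_turn_after (H.acts_step t) ?_ (acts_succ_of_mem hr)
    rw [← H.parity]
    exact ((H.mem_iff t r).1 hr).2

/-- Carries the right to act, or its absence, across the empty rounds that compression removes. -/
theorem frozen (H : TurnRun e c b g) {t s : ℕ} (hts : t ≤ s)
    (h : ∀ i, t ≤ i → i < s → ¬ (g i).Nonempty) : c s = c t ∧ b s = b t := by
  induction s, hts using Nat.le_induction with
  | base => exact ⟨rfl, rfl⟩
  | succ s hs ih =>
    obtain ⟨h1, h2⟩ := ih fun i hi hi' => h i hi (by omega)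
    have hne : ∀ r, r ∉ g s := fun r hr => h s hs (by omega) ⟨r, hr⟩
    refine ⟨?_, ?_⟩
    · rw [← h1]; funext r; exact H.clock_eq s r fun h => hne r h.1
    · rw [← h2]; funext r; exact H.parity_eq s r (hne r)

/-- After the split somebody always has the turn, and keeps it while nobody acts; fairness finally
activates this robot. -/
theorem infinite_nonempty (H : TurnRun e c b g) (he : e ∈ SSYNCH n) :
    {t | (g t).Nonempty}.Infinite := by
  by_cases hall : ∀ t, e t = Set.univ
  · have : {t | (g t).Nonempty} = Set.univ := by
      ext t
      simp only [Set.mem_ofPred_eq, Set.mem_univ, iff_true]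
      rw [H.g_eq_of_full fun i _ => hall i]
      exact he.2 t
    rw [this]
    exact Set.infinite_univ
  · push Not at hall
    classical
    have hp := Nat.find_spec hall
    have hlt : ∀ i, i < Nat.find hall → e i = Set.univ := fun i hi => by
      simpa using Nat.find_min hall hi
    obtain ⟨k, -, hbal⟩ := H.balanced he.2 hlt hp
    refine Set.infinite_of_not_bddAbove fun ⟨B, hB⟩ => ?_
    -- Beyond both the split and the supposedly last nonempty round.
    set T := max B (Nat.find hall) + 1 with hT
    obtain ⟨r, hr⟩ := (hbal T (by omega)).exists_turn
    rw [← H.parity] at hr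
    obtain ⟨s, hs, hrs⟩ := he.1.exists_ge r T
    have hno : ∀ i, T ≤ i → ¬ (g i).Nonempty := fun i hi hne => by
      have : i ≤ B := hB hne
      omega
    obtain ⟨h1, h2⟩ := H.frozen hs fun i hi _ => hno i hi
    refine hno s hs ⟨r, (H.mem_iff s r).2 ⟨hrs, ?_⟩⟩
    rw [h1, h2]
    exact hr

/-- Robots of the same team are compared through one of the other team. Any uniform bound serves for
fairness. -/
theorem acts_le (H : TurnRun e c b g) (he : ∀ t, (e t).Nonempty) (t : ℕ) (r s : Fin n) :
    acts g t r ≤ acts g t s + 2 := by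
  classical
  by_cases hall : ∀ i, i < t → e i = Set.univ
  · rw [(H.full hall).2 r s]; omega
  · push Not at hall
    have hp := (Nat.find_spec hall)
    have hlt : ∀ i, i < Nat.find hall → e i = Set.univ := fun i hi => by
      have := Nat.find_min hall hi
      push Not at this
      exact this (by omega)
    obtain ⟨k, -, hbal⟩ := H.balanced he hlt hp.2
    have hb := hbal t hp.1
    obtain ⟨b', hb'⟩ := hb.behind
    obtain ⟨a', ha'⟩ := hb.ahead
    rcases hb.clock r with h1 | h1 <;> rcases hb.clock s with h2 | h2
    · have := hb.le a' r ha' h1; have := hb.le a' s ha' h2; omega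
    · have := hb.le s r h2 h1; omega
    · have := hb.le r s h1 h2; omega
    · have := hb.le r b' h1 hb'; have := hb.le s b' h2 hb'; omega

theorem compress_mem_RSYNCH (H : TurnRun e c b g) (hn : 2 ≤ n) (he : e ∈ SSYNCH n) :
    compress g ∈ RSYNCH n := by
  classical
  have hinf := H.infinite_nonempty he
  refine ⟨compress_mem_SSYNCH hn fun r => infinite_of_acts_le 2
    (H.acts_le he.2) hinf r, ?_⟩
  by_cases hall : ∀ t, e t = Set.univ
  · left
    intro i
    change g _ = _
    rw [H.g_eq_of_full fun i _ => hall i, hall]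
  · right
    push Not at hall
    have hp := Nat.find_spec hall
    set p := Nat.find hall with hpdef
    have hlt : ∀ i, i < p → e i = Set.univ := fun i hi => by
      simpa using Nat.find_min hall hi
    obtain ⟨k, -, hbal⟩ := H.balanced he.2 hlt hp
    have hge : ∀ i, Nat.count (fun t => (g t).Nonempty) p ≤ i →
        p ≤ Nat.nth (fun t => (g t).Nonempty) i := fun i hi =>
      (Nat.le_nth_count hinf p).trans (Nat.nth_monotone hinf hi)
    -- The position of the splitting round in the compressed sequence is the number of nonempty
    -- rounds before it.
    refine ⟨Nat.count (fun t => (g t).Nonempty) p, fun i hi => ?_, fun i hi => ⟨?_, ?_, ?_⟩⟩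
    · have h1 := Nat.nth_lt_of_lt_count hi
      change g _ = _
      rw [H.g_eq_of_full fun j hj => hlt j (by omega), hlt _ h1]
    · exact Nat.nth_mem_of_infinite hinf i
    · change g _ ≠ _
      rcases (hge i hi).eq_or_lt with h1 | h1
      · rw [← h1, H.g_eq_of_full hlt]
        exact hp
      · intro hu
        obtain ⟨r, hr⟩ := (hbal _ h1).exists_not_turn
        rw [← H.parity] at hr
        have : r ∈ g (Nat.nth (fun t => (g t).Nonempty) i) := by rw [hu]; trivial
        exact hr ((H.mem_iff _ r).1 this).2
    · refine Set.eq_empty_of_forall_notMem fun r ⟨hr, hr'⟩ => ?_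
      change r ∈ g _ at hr
      change r ∈ g _ at hr'
      have h1 := H.not_turn_after he.2 hlt hp (hge i hi) hr
      have hmono : Nat.nth (fun t => (g t).Nonempty) i < Nat.nth (fun t => (g t).Nonempty) (i + 1) :=
        Nat.nth_strictMono hinf (by omega)
      -- No round strictly between two consecutive values of `Nat.nth` is nonempty, so a robot
      -- refused right after acting is still refused at the next nonempty round.
      obtain ⟨h2, h3⟩ := H.frozen (t := Nat.nth (fun t => (g t).Nonempty) i + 1) hmono
        (fun j hj hj' hne => by
          have h4 := Nat.count_monotone (fun t => (g t).Nonempty) hj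
          rw [Nat.count_succ, Nat.count_nth_of_infinite hinf,
            if_pos (Nat.nth_mem_of_infinite hinf i)] at h4
          have h5 := Nat.nth_monotone hinf h4
          rw [Nat.nth_count hne] at h5
          omega)
      rw [← h2, ← h3] at h1
      exact h1 ((H.mem_iff _ r).1 hr').2

end TurnRun

end Turns

open Classical in
/-- `LUMI` robots that run `A` in turns, see `Turn`. The state of a robot consists of its lights
in `A`, its clock and its parity bit. -/
noncomputable def Algorithm.inTurns (A : Algorithm) : Algorithm where
  Idx := Unit
  finite_idx := inferInstance
  Color _ := A.Light × ZMod 3 × ZMod 2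
  finite_color _ := by
    have := A.finite_idx
    have := A.finite_color
    infer_instance
  off _ := (A.off, 0, 0)
  compute own V :=
    let l : A.Light × ZMod 3 × ZMod 2 := (own.getD fun _ => (A.off, 0, 0)) ()
    let W : Multiset (ℂ × (A.Light × ZMod 3 × ZMod 2)) :=
      V.map fun v => (v.1, (v.2.getD fun _ => (A.off, 0, 0)) ())
    let same : Prop := ∀ w ∈ W, w.2.2.1 = l.2.1
    let turn : Prop := same ∨
      ((∃ w ∈ W, w.2.2.1 = l.2.1 + 1) ∧ ∀ w ∈ W, w.2.2.1 = l.2.1 + 1 → w.2.2.2 ≠ l.2.2) ∨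
      ((∃ w ∈ W, w.2.2.1 = l.2.1 - 1) ∧ ∀ w ∈ W, w.2.2.1 = l.2.1 - 1 → w.2.2.2 = l.2.2)
    let out := A.compute (some l.1) (W.map fun w => (w.1, some w.2.1))
    if turn then
      (fun _ => some (fun i => (out.1 i).getD (l.1 i),
        if same then l.2.1 + 1 else l.2.1, l.2.2 + 1), out.2)
    else (fun _ => none, 0)

/-! ### The execution simulated by robots that act in turns. -/

namespace InTurns

variable {A : Algorithm} {n : ℕ}

/-- The clock of a robot. -/
def clock (K : Config A.inTurns n) (r : Fin n) : ZMod 3 := (K.light r ()).2.1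

/-- The parity bit of a robot. -/
def parity (K : Config A.inTurns n) (r : Fin n) : ZMod 2 := (K.light r ()).2.2

/-- The simulated configuration. -/
def sim (K : Config A.inTurns n) : Config A n := ⟨K.pos, fun r => (K.light r ()).1⟩

open Classical in
theorem output_eq (F : Fin n → Frame) (K : Config A.inTurns n) (r : Fin n) :
    output .LUMI F K r =
      if Turn (clock K) (parity K) r then
        (fun _ => some (fun i => ((output .LUMI F (sim K) r).1 i).getD ((sim K).light r i),
          if ∀ s, s ≠ r → clock K s = clock K r then clock K r + 1 else clock K r,
          parity K r + 1), (output .LUMI F (sim K) r).2)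
      else (fun _ => none, 0) := by
  simp only [output, snapshot, Algorithm.inTurns, Model.seesOwn, Model.seesOthers,
    Multiset.map_map, Function.comp_def, if_true, Option.getD_some, Multiset.mem_map,
    Finset.mem_val, Finset.mem_erase, Finset.mem_univ, and_true, forall_exists_index, and_imp,
    forall_apply_eq_imp_iff₂, exists_exists_and_eq_and, Turn, clock, parity, sim]
  rfl

theorem round_sim {rigid : Bool} {δ : ℝ} {F : Fin n → Frame} {e : Set (Fin n)}
    {K K' : Config A.inTurns n} (h : Round .LUMI rigid δ F e K K') :
    Round .LUMI rigid δ F {r | r ∈ e ∧ Turn (clock K) (parity K) r} (sim K) (sim K') := by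
  intro r
  constructor
  · intro hr
    by_cases hre : r ∈ e
    · obtain ⟨h1, h2⟩ := (h r).2 hre
      have ht : ¬ Turn (clock K) (parity K) r := fun ht => hr ⟨hre, ht⟩
      simp only [output_eq, if_neg ht, Frame.toGlobal_zero, add_zero] at h1 h2
      exact ⟨h1.eq_of_stay, congrArg Prod.fst (h2 ())⟩
    · obtain ⟨h1, h2⟩ := (h r).1 hre
      exact ⟨h1, by simp only [sim, h2]⟩
  · rintro ⟨hre, ht⟩
    obtain ⟨h1, h2⟩ := (h r).2 hre
    simp only [output_eq, if_pos ht] at h1 h2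
    exact ⟨h1, fun i => congrFun (congrArg Prod.fst (h2 ())) i⟩

theorem turnRun {rigid : Bool} {δ : ℝ} {F : Fin n → Frame} {e : ActivationSeq n}
    {K : ℕ → Config A.inTurns n} (hoff : ∀ r, (K 0).light r = A.inTurns.off)
    (h : ∀ t, Round .LUMI rigid δ F (e t) (K t) (K (t + 1))) :
    TurnRun e (fun t => clock (K t)) (fun t => parity (K t))
      fun t => {r | r ∈ e t ∧ Turn (clock (K t)) (parity (K t)) r} := by
  have hmem : ∀ t r, r ∈ e t → Turn (clock (K t)) (parity (K t)) r →
      (∀ s, s ≠ r → clock (K t) s = clock (K t) r) →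
        clock (K (t + 1)) r = clock (K t) r + 1 := by
    intro t r hre ht hs
    have h2 := ((h t r).2 hre).2 ()
    simp only [output_eq, if_pos ht, if_pos hs] at h2
    exact congrArg (fun l => l.2.1) h2
  have hmem' : ∀ t r, r ∈ e t → Turn (clock (K t)) (parity (K t)) r →
      ¬ (∀ s, s ≠ r → clock (K t) s = clock (K t) r) →
        clock (K (t + 1)) r = clock (K t) r := by
    intro t r hre ht hs
    have h2 := ((h t r).2 hre).2 ()
    simp only [output_eq, if_pos ht, if_neg hs] at h2
    exact congrArg (fun l => l.2.1) h2
  have hstay : ∀ t r, ¬ (r ∈ e t ∧ Turn (clock (K t)) (parity (K t)) r) →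
      (K (t + 1)).light r () = (K t).light r () := by
    intro t r hr
    by_cases hre : r ∈ e t
    · have h2 := ((h t r).2 hre).2 ()
      have ht : ¬ Turn (clock (K t)) (parity (K t)) r := fun ht => hr ⟨hre, ht⟩
      simp only [output_eq, if_neg ht] at h2
      exact h2
    · rw [((h t r).1 hre).2]
  constructor
  · intro r; simp only [clock, hoff]; rfl
  · intro r; simp only [parity, hoff]; rfl
  · intro t r; rfl
  · rintro t r ⟨h1, h2⟩ h3; exact hmem t r h1 h2 h3
  · intro t r h1
    by_cases hr : r ∈ e t ∧ Turn (clock (K t)) (parity (K t)) r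
    · exact hmem' t r hr.1 hr.2 fun h2 => h1 ⟨hr, h2⟩
    · simp only [clock, hstay t r hr]
  · rintro t r ⟨h1, ht⟩
    have h2 := ((h t r).2 h1).2 ()
    simp only [output_eq, if_pos ht] at h2
    exact congrArg (fun l => l.2.2) h2
  · intro t r hr
    simp only [parity, hstay t r hr]

end InTurns

theorem lumi_SSYNCH_notLessPowerful_lumi_RSYNCH :
    NotLessPowerful .LUMI SSYNCH .LUMI RSYNCH := by
  rintro R P ⟨A, hA⟩
  refine ⟨A.inTurns, fun F hF δ hδ e he K h0 hoff hK => ?_⟩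
  have H := InTurns.turnRun hoff hK
  exact valid_of_simulation hA hF hδ (H.infinite_nonempty he)
    (H.compress_mem_RSYNCH R.two_le he) (L := fun t => InTurns.sim (K t)) h0
    (fun r => by simp only [InTurns.sim, hoff]; rfl) fun t => InTurns.round_sim (hK t)

/-! ### `FCOM` robots that remember

A robot cannot see its own state, but it can compute it if some other robot publishes the sum of
the states of all robots but itself, the states being identified with the elements of a group.
Hence the execution proceeds in epochs. If all other robots have published in the current epoch
`k`, which they show as the stage `(k, false)`, then an active robot recovers its own state and
may act, which it shows as the stage `(k, true)`. Then the next epoch begins, and the sums are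
published again. In order to be fair, a robot does not act if it has acted more often than
another one; the states contain the number of actions modulo 3. -/

/-- Output of the two lights. -/
def lightsOf {X Y : Type} (x : Option X) (y : Option Y) : ∀ i : Bool, Option (cond i X Y)
  | true => x
  | false => y

section Board

variable (A : Algorithm) {N : ℕ} (code : A.Light × ZMod 3 ≃ ZMod N)

/-- A visible robot: its place, its state, its stage, and the sum it publishes. -/
abbrev Sight (A : Algorithm) (N : ℕ) : Type :=
  ℂ × (A.Light × ZMod 3) × (ZMod 3 × Bool) × ZMod N

open Classical in
/-- What a robot does that sees `W`. -/
noncomputable def boardCompute (W : Multiset (Sight A N)) :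
    (∀ i : Bool, Option (cond i (A.Light × ZMod 3) ((ZMod 3 × Bool) × ZMod N))) × ℂ :=
  let total : ZMod N := (W.map fun w => code w.2.1).sum
  -- A correct sum of `w` plus the visible state of `w` is the sum over all robots, that is, `total`
  -- plus the state `x.2` of the observer.
  if h : ∃ x : ZMod 3 × (A.Light × ZMod 3), ∀ w ∈ W,
      w.2.2.1 = (x.1, false) ∧ w.2.2.2 + code w.2.1 = code x.2 + total then
    let x := h.choose
    -- Counts will differ by at most one, so the residue `x.2.2 - 1` marks a robot that has acted
    -- less often.
    if ∀ w ∈ W, w.2.1.2 ≠ x.2.2 - 1 then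
      let out := A.compute (some x.2.1) (W.map fun w => (w.1, some w.2.1.1))
      (lightsOf (some (fun i => (out.1 i).getD (x.2.1 i), x.2.2 + 1))
        (some ((x.1, true), total)), out.2)
    else (lightsOf none (some ((x.1, false), total)), 0)
  -- Epoch `k` is over if somebody has acted in it or has already gone on to the next one.
  else if h : ∃ k : ZMod 3, (∃ w ∈ W, w.2.2.1 = (k, true)) ∨
      ((∃ w ∈ W, w.2.2.1 = (k, false)) ∧ ∃ w ∈ W, w.2.2.1 = (k + 1, false)) then
    (lightsOf none (some ((h.choose + 1, false), total)), 0)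
  else (lightsOf none none, 0)

variable {A}

/-- A single visible robot determines the epoch and, by cancellation in the group, the own state, so
the choice in `boardCompute` is forced. -/
theorem boardCompute_recover {W : Multiset (Sight A N)} {w₀ : Sight A N} (hw₀ : w₀ ∈ W)
    {k : ZMod 3} {σ : A.Light × ZMod 3}
    (h : ∀ w ∈ W, w.2.2.1 = (k, false) ∧
      w.2.2.2 + code w.2.1 = code σ + (W.map fun w => code w.2.1).sum) :
    (∃ x : ZMod 3 × (A.Light × ZMod 3), ∀ w ∈ W, w.2.2.1 = (x.1, false) ∧
      w.2.2.2 + code w.2.1 = code x.2 + (W.map fun w => code w.2.1).sum) ∧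
    ∀ x : ZMod 3 × (A.Light × ZMod 3), (∀ w ∈ W, w.2.2.1 = (x.1, false) ∧
      w.2.2.2 + code w.2.1 = code x.2 + (W.map fun w => code w.2.1).sum) → x = (k, σ) := by
  refine ⟨⟨(k, σ), h⟩, fun x hx => ?_⟩
  obtain ⟨h1, h2⟩ := h w₀ hw₀
  obtain ⟨h3, h4⟩ := hx w₀ hw₀
  rw [h1] at h3
  rw [h2] at h4
  exact Prod.ext (congrArg Prod.fst h3).symm (code.injective <| add_right_cancel h4).symm

theorem boardCompute_act {W : Multiset (Sight A N)} {w₀ : Sight A N} (hw₀ : w₀ ∈ W)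
    {k : ZMod 3} {σ : A.Light × ZMod 3}
    (h : ∀ w ∈ W, w.2.2.1 = (k, false) ∧
      w.2.2.2 + code w.2.1 = code σ + (W.map fun w => code w.2.1).sum)
    (hσ : ∀ w ∈ W, w.2.1.2 ≠ σ.2 - 1) :
    boardCompute A code W =
      (lightsOf (some (fun i => ((A.compute (some σ.1)
          (W.map fun w => (w.1, some w.2.1.1))).1 i).getD (σ.1 i), σ.2 + 1))
        (some ((k, true), (W.map fun w => code w.2.1).sum)),
        (A.compute (some σ.1) (W.map fun w => (w.1, some w.2.1.1))).2) := by
  obtain ⟨h1, h2⟩ := boardCompute_recover code hw₀ h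
  have h3 := h2 _ h1.choose_spec
  simp only [boardCompute, dif_pos h1, h3, if_pos hσ]

theorem boardCompute_wait {W : Multiset (Sight A N)} {w₀ : Sight A N} (hw₀ : w₀ ∈ W)
    {k : ZMod 3} {σ : A.Light × ZMod 3}
    (h : ∀ w ∈ W, w.2.2.1 = (k, false) ∧
      w.2.2.2 + code w.2.1 = code σ + (W.map fun w => code w.2.1).sum)
    (hσ : ¬ ∀ w ∈ W, w.2.1.2 ≠ σ.2 - 1) :
    boardCompute A code W =
      (lightsOf none (some ((k, false), (W.map fun w => code w.2.1).sum)), 0) := by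
  obtain ⟨h1, h2⟩ := boardCompute_recover code hw₀ h
  have h3 := h2 _ h1.choose_spec
  simp only [boardCompute, dif_pos h1, h3, if_neg hσ]

/-- Only two consecutive epochs are visible at a time, and three epoch names suffice to tell the
older from the newer one; hence the chosen epoch is `k`. -/
theorem boardCompute_refresh {W : Multiset (Sight A N)} {k : ZMod 3}
    (h : ∀ w ∈ W, w.2.2.1 = (k, false) ∨ w.2.2.1 = (k, true) ∨ w.2.2.1 = (k + 1, false))
    (hs : ∃ w ∈ W, w.2.2.1 = (k, true) ∨ w.2.2.1 = (k + 1, false))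
    (hn : ¬ ∀ w ∈ W, w.2.2.1 = (k + 1, false)) :
    boardCompute A code W =
      (lightsOf none (some ((k + 1, false), (W.map fun w => code w.2.1).sum)), 0) := by
  obtain ⟨z1, z2, z3, -⟩ := zmod_three_facts k
  have h1 : ¬ ∃ x : ZMod 3 × (A.Light × ZMod 3), ∀ w ∈ W, w.2.2.1 = (x.1, false) ∧
      w.2.2.2 + code w.2.1 = code x.2 + (W.map fun w => code w.2.1).sum := by
    rintro ⟨x, hx⟩
    obtain ⟨w, hw, h1⟩ := hs
    have h2 := (hx w hw).1
    rcases h1 with h1 | h1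
    · rw [h1] at h2; simp at h2
    · refine hn fun w' hw' => ?_
      rw [(hx w' hw').1, ← h1, h2]
  have h2 : ∃ j : ZMod 3, (∃ w ∈ W, w.2.2.1 = (j, true)) ∨
      ((∃ w ∈ W, w.2.2.1 = (j, false)) ∧ ∃ w ∈ W, w.2.2.1 = (j + 1, false)) := by
    refine ⟨k, ?_⟩
    by_cases hx : ∃ w ∈ W, w.2.2.1 = (k, true)
    · exact Or.inl hx
    · right
      push Not at hn
      obtain ⟨w, hw, h1⟩ := hs
      obtain ⟨w', hw', h1'⟩ := hn
      refine ⟨⟨w', hw', ?_⟩, ⟨w, hw, ?_⟩⟩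
      · rcases h w' hw' with h2 | h2 | h2
        · exact h2
        · exact absurd ⟨w', hw', h2⟩ hx
        · exact absurd h2 h1'
      · rcases h1 with h1 | h1
        · exact absurd ⟨w, hw, h1⟩ hx
        · exact h1
  have huniq : ∀ j : ZMod 3, ((∃ w ∈ W, w.2.2.1 = (j, true)) ∨
      ((∃ w ∈ W, w.2.2.1 = (j, false)) ∧ ∃ w ∈ W, w.2.2.1 = (j + 1, false))) → j = k := by
    rintro j (⟨w, hw, h3⟩ | ⟨⟨w, hw, h3⟩, ⟨w', hw', h4⟩⟩)
    · rcases h w hw with h5 | h5 | h5 <;> rw [h3] at h5 <;> simp at h5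
      exact h5
    · rcases h w hw with h5 | h5 | h5 <;> rw [h3] at h5 <;> simp at h5
      · exact h5
      · rw [h5] at h4
        rcases h w' hw' with h6 | h6 | h6 <;> rw [h4] at h6 <;> simp at h6
        exact absurd h6 z2
  have h3 := huniq _ h2.choose_spec
  simp only [boardCompute, dif_neg h1, dif_pos h2, h3]

variable (A)

/-- `FCOM` robots that run the `LUMI` algorithm `A`. -/
noncomputable def Algorithm.onBoard : Algorithm where
  Idx := Bool
  finite_idx := inferInstance
  Color i := cond i (A.Light × ZMod 3) ((ZMod 3 × Bool) × ZMod N)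
  finite_color i := by
    have := A.finite_idx
    have := A.finite_color
    have : Finite (ZMod N) := Finite.of_equiv _ code
    cases i
    · exact inferInstanceAs (Finite ((ZMod 3 × Bool) × ZMod N))
    · exact inferInstanceAs (Finite (A.Light × ZMod 3))
  off
    | true => (A.off, 0)
    | false => ((0, false), 0)
  -- The default colors are irrelevant in `FCOM`, where the lights of the others are always visible.
  compute _ V := boardCompute A code (V.map fun v =>
    (v.1, v.2.elim (A.off, 0) (· true), v.2.elim ((0, false), 0) (· false)))

end Board

/-! ### Correctness and fairness of the simulation by published sums. -/

namespace OnBoard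

variable {A : Algorithm} {N : ℕ} {code : A.Light × ZMod 3 ≃ ZMod N} {n : ℕ}

/-- The lights in `A` of a robot, and the number of its actions. -/
def state (K : Config (A.onBoard code) n) (r : Fin n) : A.Light × ZMod 3 := K.light r true

/-- The stage of a robot. -/
def stage (K : Config (A.onBoard code) n) (r : Fin n) : ZMod 3 × Bool := (K.light r false).1

/-- The sum that a robot publishes. -/
def board (K : Config (A.onBoard code) n) (r : Fin n) : ZMod N := (K.light r false).2

/-- The simulated configuration. -/
def sim (K : Config (A.onBoard code) n) : Config A n := ⟨K.pos, fun r => (state K r).1⟩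

/-- The sum that `r` should publish. -/
def sumOthers (K : Config (A.onBoard code) n) (r : Fin n) : ZMod N :=
  ∑ s ∈ Finset.univ.erase r, code (state K s)

/-- What `r` sees. -/
noncomputable def sights (F : Fin n → Frame) (K : Config (A.onBoard code) n) (r : Fin n) :
    Multiset (Sight A N) :=
  (Finset.univ.erase r).val.map fun s =>
    ((F r).toLocal (K.pos s - K.pos r), state K s, stage K s, board K s)

theorem output_eq (F : Fin n → Frame) (K : Config (A.onBoard code) n) (r : Fin n) :
    output .FCOM F K r = boardCompute A code (sights F K r) := by
  simp only [output, snapshot, Algorithm.onBoard, Model.seesOwn, Model.seesOthers,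
    Multiset.map_map, Function.comp_def, if_true]
  rfl

theorem mem_sights {F : Fin n → Frame} {K : Config (A.onBoard code) n} {r : Fin n}
    {p : Sight A N → Prop} : (∀ w ∈ sights F K r, p w) ↔
      ∀ s, s ≠ r → p ((F r).toLocal (K.pos s - K.pos r), state K s, stage K s, board K s) := by
  simp only [sights, Multiset.mem_map, Finset.mem_val, Finset.mem_erase, Finset.mem_univ, and_true,
    forall_exists_index, and_imp, forall_apply_eq_imp_iff₂]

theorem sum_sights (F : Fin n → Frame) (K : Config (A.onBoard code) n) (r : Fin n) :
    ((sights F K r).map fun w => code w.2.1).sum = sumOthers K r := by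
  simp only [sights, Multiset.map_map, Function.comp_def, sumOthers]
  rfl

theorem map_sights (F : Fin n → Frame) (K : Config (A.onBoard code) n) (r : Fin n) :
    ((sights F K r).map fun w => (w.1, some w.2.1.1)) = snapshot .LUMI F (sim K) r := by
  simp only [sights, Multiset.map_map, Function.comp_def, snapshot, Model.seesOthers, if_true]
  rfl

theorem sumOthers_add (K : Config (A.onBoard code) n) (r : Fin n) :
    sumOthers K r + code (state K r) = ∑ s, code (state K s) :=
  Finset.sum_erase_add _ _ (Finset.mem_univ r)

/-- The robots that have not yet reached epoch `k + 1` are in epoch `k`, the others publish the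
right sums. -/
def Stages (k : ZMod 3) (K : Config (A.onBoard code) n) : Prop :=
  ∀ q, stage K q = (k, false) ∨ stage K q = (k, true) ∨
    (stage K q = (k + 1, false) ∧ board K q = sumOthers K q)

/-- Robot `r` acts if it is active. -/
def Ready (K : Config (A.onBoard code) n) (r : Fin n) : Prop :=
  (∃ k, ∀ q, q ≠ r → stage K q = (k, false)) ∧ ∀ q, q ≠ r → (state K q).2 ≠ (state K r).2 - 1

/-- Robot `q` shows that epoch `k` is over. -/
def Over (k : ZMod 3) (K : Config (A.onBoard code) n) (q : Fin n) : Prop :=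
  stage K q = (k, true) ∨ stage K q = (k + 1, false)

/-- The others of a ready robot share one stage without the action mark; a witness that epoch `k` is
over leaves only epoch `k + 1` for it. -/
theorem Ready.stage_eq {k : ZMod 3} {K : Config (A.onBoard code) n} {r : Fin n}
    (hr : Ready K r) (hs : ∃ q, q ≠ r ∧ Over k K q) :
    ∀ q, q ≠ r → stage K q = (k + 1, false) := by
  obtain ⟨⟨j, hj⟩, -⟩ := hr
  obtain ⟨q, hq, h1⟩ := hs
  have h2 := hj q hq
  rcases h1 with h1 | h1
  · rw [h1] at h2; simp at h2
  · intro q' hq'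
    rw [hj q' hq', ← h2, h1]

theorem Stages.fresh {k : ZMod 3} {K : Config (A.onBoard code) n} (h : Stages k K) {q : Fin n}
    (hq : stage K q = (k + 1, false)) : board K q = sumOthers K q := by
  have z1 := (zmod_three_facts k).1
  rcases h q with h1 | h1 | h1
  · rw [h1] at hq; simp at hq
  · rw [h1] at hq; simp at hq
  · exact h1.2

/-- Both sides of the equation are the sum of the codes of all robots. -/
theorem recover {k : ZMod 3} {K : Config (A.onBoard code) n} (h : Stages k K) {r : Fin n}
    (hall : ∀ q, q ≠ r → stage K q = (k + 1, false)) (F : Fin n → Frame) :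
    ∀ w ∈ sights F K r, w.2.2.1 = (k + 1, false) ∧
      w.2.2.2 + code w.2.1 =
        code (state K r) + ((sights F K r).map fun w => code w.2.1).sum := by
  rw [mem_sights]
  intro s hs
  refine ⟨hall s hs, ?_⟩
  simp only [sum_sights, h.fresh (hall s hs), sumOthers_add]
  rw [add_comm, sumOthers_add]

theorem output_of_ready {k : ZMod 3} {K : Config (A.onBoard code) n} (h : Stages k K)
    {r : Fin n} (hs : ∃ q, q ≠ r ∧ Over k K q) (hr : Ready K r) (F : Fin n → Frame) :
    output .FCOM F K r =
      (lightsOf (some (fun i => ((output .LUMI F (sim K) r).1 i).getD ((sim K).light r i),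
        (state K r).2 + 1)) (some ((k + 1, true), sumOthers K r)),
        (output .LUMI F (sim K) r).2) := by
  obtain ⟨q, hq, -⟩ := id hs
  have hw : ((F r).toLocal (K.pos q - K.pos r), state K q, stage K q, board K q) ∈
      sights F K r := Multiset.mem_map.2 ⟨q, Finset.mem_erase.2 ⟨hq, Finset.mem_univ q⟩, rfl⟩
  rw [output_eq, boardCompute_act code hw (recover h (hr.stage_eq hs) F)
    (mem_sights.2 hr.2), sum_sights, map_sights]
  rfl

theorem output_of_not_ready {k : ZMod 3} {K : Config (A.onBoard code) n} (h : Stages k K)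
    {r : Fin n} (hs : ∃ q, q ≠ r ∧ Over k K q) (hr : ¬ Ready K r) (F : Fin n → Frame) :
    output .FCOM F K r = (lightsOf none (some ((k + 1, false), sumOthers K r)), 0) := by
  obtain ⟨q, hq, hq'⟩ := id hs
  have hw : ((F r).toLocal (K.pos q - K.pos r), state K q, stage K q, board K q) ∈
      sights F K r := Multiset.mem_map.2 ⟨q, Finset.mem_erase.2 ⟨hq, Finset.mem_univ q⟩, rfl⟩
  rw [output_eq, ← sum_sights F]
  by_cases hall : ∀ q, q ≠ r → stage K q = (k + 1, false)
  · refine boardCompute_wait code hw (recover h hall F) fun h1 => hr ⟨⟨_, hall⟩, ?_⟩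
    exact mem_sights.1 h1
  · refine boardCompute_refresh code (mem_sights.2 fun s _ => ?_) ⟨_, hw, hq'⟩
      fun h1 => hall (mem_sights.1 h1)
    rcases h s with h1 | h1 | h1
    · exact Or.inl h1
    · exact Or.inr (Or.inl h1)
    · exact Or.inr (Or.inr h1.1)

/-- The effect of a round on the states, the stages and the sums, and on the simulated
configuration. -/
theorem round_effect {rigid : Bool} {δ : ℝ} {F : Fin n → Frame} {e : Set (Fin n)}
    {K K' : Config (A.onBoard code) n} (hK : Round .FCOM rigid δ F e K K') {k : ZMod 3}
    (h : Stages k K) (hs : ∀ r ∈ e, ∃ q, q ≠ r ∧ Over k K q) :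
    Round .LUMI rigid δ F {r | r ∈ e ∧ Ready K r} (sim K) (sim K') ∧
    (∀ r ∈ e, Ready K r → (state K' r).2 = (state K r).2 + 1 ∧ stage K' r = (k + 1, true)) ∧
    (∀ r, ¬ (r ∈ e ∧ Ready K r) → state K' r = state K r) ∧
    (∀ r ∈ e, ¬ Ready K r → stage K' r = (k + 1, false) ∧ board K' r = sumOthers K r) ∧
    ∀ r, r ∉ e → stage K' r = stage K r ∧ board K' r = board K r := by
  have hact : ∀ r ∈ e, Ready K r → state K' r =
      (fun i => ((output .LUMI F (sim K) r).1 i).getD ((sim K).light r i), (state K r).2 + 1) ∧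
      stage K' r = (k + 1, true) := by
    intro r hre hr
    have h2 := ((hK r).2 hre).2
    rw [output_of_ready h (hs r hre) hr] at h2
    exact ⟨h2 true, congrArg Prod.fst (h2 false)⟩
  have hwait : ∀ r ∈ e, ¬ Ready K r → K'.pos r = K.pos r ∧ state K' r = state K r ∧
      stage K' r = (k + 1, false) ∧ board K' r = sumOthers K r := by
    intro r hre hr
    obtain ⟨h1, h2⟩ := (hK r).2 hre
    rw [output_of_not_ready h (hs r hre) hr] at h1 h2
    simp only [Frame.toGlobal_zero, add_zero] at h1
    exact ⟨h1.eq_of_stay, h2 true, congrArg Prod.fst (h2 false), congrArg Prod.snd (h2 false)⟩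
  have hstay : ∀ r, ¬ (r ∈ e ∧ Ready K r) → K'.pos r = K.pos r ∧ state K' r = state K r := by
    intro r hr
    by_cases hre : r ∈ e
    · have := hwait r hre fun h => hr ⟨hre, h⟩
      exact ⟨this.1, this.2.1⟩
    · obtain ⟨h1, h2⟩ := (hK r).1 hre
      exact ⟨h1, by unfold state; rw [h2]⟩
  refine ⟨fun r => ⟨fun hr => ?_, fun hr => ⟨?_, fun i => ?_⟩⟩, fun r hre hr => ?_,
    fun r hr => (hstay r hr).2, fun r hre hr => (hwait r hre hr).2.2, fun r hre => ?_⟩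
  · exact ⟨(hstay r hr).1, congrArg Prod.fst (hstay r hr).2⟩
  · have h1 := ((hK r).2 hr.1).1
    rw [output_of_ready h (hs r hr.1) hr.2] at h1
    exact h1
  · exact congrFun (congrArg Prod.fst (hact r hr.1 hr.2).1) i
  · exact ⟨congrArg Prod.snd (hact r hre hr).1, (hact r hre hr).2⟩
  · simp only [stage, board, ((hK r).1 hre).2, and_self]

/-- The robots that act in round `t`. -/
def acting (e : ActivationSeq n) (K : ℕ → Config (A.onBoard code) n) (t : ℕ) : Set (Fin n) :=
  {r | r ∈ e t ∧ Ready (K t) r}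

/-- The invariant of executions under `RSYNCH`. Either all robots have done the same, or some
robot that will not be active in the next round shows that epoch `k` is over. -/
structure Inv (e : ActivationSeq n) (K : ℕ → Config (A.onBoard code) n) (k : ZMod 3) (t : ℕ) :
    Prop where
  stages : Stages k (K t)
  isOver : ((∀ r s, acts (acting e K) t r = acts (acting e K) t s) ∧
      ((∀ q, stage (K t) q = (k, true)) ∨ ∀ q, stage (K t) q = (k + 1, false))) ∨
    ∃ q, q ∉ e t ∧ Over k (K t) q
  count : ∀ r, (state (K t) r).2 = acts (acting e K) t r
  le : ∀ r s, acts (acting e K) t r ≤ acts (acting e K) t s + 1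

variable {e : ActivationSeq n} {K : ℕ → Config (A.onBoard code) n} {k : ZMod 3} {t : ℕ}

theorem Inv.sees (hn : 2 ≤ n) (h : Inv e K k t) (r : Fin n) (hr : r ∈ e t) :
    ∃ q, q ≠ r ∧ Over k (K t) q := by
  rcases h.isOver with ⟨-, h1⟩ | ⟨q, hq, h1⟩
  · have : Nontrivial (Fin n) := Fin.nontrivial_iff_two_le.2 hn
    obtain ⟨q, hq⟩ := exists_ne r
    exact ⟨q, hq, h1.imp (fun h => h q) fun h => h q⟩
  · exact ⟨q, by rintro rfl; exact hq hr, h1⟩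

/-- A lead over `s` is exactly one by `le`, and then the residue of `s` is the forbidden one. -/
theorem Inv.ready_le (h : Inv e K k t) {r : Fin n} (hr : Ready (K t) r) (s : Fin n) :
    acts (acting e K) t r ≤ acts (acting e K) t s := by
  by_contra hc
  have h1 : acts (acting e K) t r = acts (acting e K) t s + 1 := by
    have := h.le r s; omega
  refine hr.2 s (by rintro rfl; omega) ?_
  rw [h.count, h.count, h1]
  push_cast
  ring

/-- If `r` has the minimal count `m`, the others have `m` or `m + 1`, and neither is `m - 1` modulo
3. -/
theorem Inv.ready_of_le (h : Inv e K k t) {r : Fin n}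
    (hle : ∀ s, acts (acting e K) t r ≤ acts (acting e K) t s)
    (hall : ∀ q, stage (K t) q = (k + 1, false)) : Ready (K t) r := by
  refine ⟨⟨k + 1, fun q _ => hall q⟩, fun q _ => ?_⟩
  rw [h.count, h.count]
  obtain ⟨-, -, -, z4, z5, -⟩ := zmod_three_facts (acts (acting e K) t r : ZMod 3)
  have h1 := hle q
  have h2 := h.le q r
  rcases h1.eq_or_lt with h3 | h3
  · rw [← h3]; exact z4.symm
  · have h4 : acts (acting e K) t q = acts (acting e K) t r + 1 := by omega
    rw [h4]; push_cast; exact z5.symm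

theorem Inv.counts_succ {rigid : Bool} {δ : ℝ} {F : Fin n → Frame} (hn : 2 ≤ n)
    (h : Inv e K k t) (hK : Round .FCOM rigid δ F (e t) (K t) (K (t + 1))) :
    (∀ r, (state (K (t + 1)) r).2 = acts (acting e K) (t + 1) r) ∧
    ∀ r s, acts (acting e K) (t + 1) r ≤ acts (acting e K) (t + 1) s + 1 := by
  obtain ⟨-, h1, h2, -, -⟩ := round_effect hK h.stages (h.sees hn)
  have hmono : ∀ s, acts (acting e K) t s ≤ acts (acting e K) (t + 1) s := fun s => by
    by_cases hs : s ∈ acting e K t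
    · rw [acts_succ_of_mem hs]; omega
    · rw [acts_succ_of_notMem hs]
  constructor
  · intro r
    by_cases hr : r ∈ acting e K t
    · rw [(h1 r hr.1 hr.2).1, acts_succ_of_mem hr, h.count]
      push_cast; rfl
    · rw [h2 r hr, acts_succ_of_notMem hr, h.count]
  · intro r s
    have h3 := hmono s
    by_cases hr : r ∈ acting e K t
    · rw [acts_succ_of_mem hr]
      have := h.ready_le hr.2 s
      omega
    · rw [acts_succ_of_notMem hr]
      have := h.le r s
      omega

/-- No state changes, so correct sums remain correct, and every active robot joins epoch `k + 1`. If
the round is not full, any of these robots is idle in the next round and serves as the witness for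
`isOver`. -/
theorem Inv.succ_of_not_nonempty {rigid : Bool} {δ : ℝ} {F : Fin n → Frame} (hn : 2 ≤ n)
    (he : e ∈ RSYNCH n) (h : Inv e K k t)
    (hK : Round .FCOM rigid δ F (e t) (K t) (K (t + 1))) (hg : ¬ (acting e K t).Nonempty) :
    Inv e K k (t + 1) ∧ ∀ r ∈ e t, stage (K (t + 1)) r = (k + 1, false) := by
  obtain ⟨-, -, h2, h3, h4⟩ := round_effect hK h.stages (h.sees hn)
  obtain ⟨h5, h6⟩ := h.counts_succ hn hK
  have hno : ∀ r, r ∉ acting e K t := fun r hr => hg ⟨r, hr⟩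
  have hstate : state (K (t + 1)) = state (K t) := funext fun r => h2 r (hno r)
  have hsum : sumOthers (K (t + 1)) = sumOthers (K t) := by
    funext r; simp only [sumOthers, hstate]
  have hstage : ∀ r ∈ e t, stage (K (t + 1)) r = (k + 1, false) := fun r hr =>
    (h3 r hr fun h => hno r ⟨hr, h⟩).1
  refine ⟨⟨fun q => ?_, ?_, h5, h6⟩, hstage⟩
  · by_cases hq : q ∈ e t
    · refine Or.inr (Or.inr ⟨hstage q hq, ?_⟩)
      rw [hsum, (h3 q hq fun h => hno q ⟨hq, h⟩).2]
    · rw [(h4 q hq).1, (h4 q hq).2, hsum]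
      exact h.stages q
  · by_cases hu : e t = Set.univ
    · left
      refine ⟨?_, Or.inr fun q => hstage q (by rw [hu]; trivial)⟩
      rcases h.isOver with ⟨h7, -⟩ | ⟨q, hq, -⟩
      · intro r s
        rw [acts_succ_of_notMem (hno r), acts_succ_of_notMem (hno s), h7 r s]
      · exact absurd (hu ▸ trivial) hq
    · right
      obtain ⟨q, hq⟩ := he.1.2 t
      refine ⟨q, fun hq' => ?_, Or.inr (hstage q hq)⟩
      have : q ∈ e t ∩ e (t + 1) := ⟨hq, hq'⟩
      rw [RSYNCH.inter_eq_empty he hu] at this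
      exact this

/-- One acting robot certifies that all others are in epoch `k + 1`. That epoch now counts as the
old one, whose sums are no longer trusted. In a full round all robots act together; otherwise an
acting robot is idle in the next round and shows the end of the epoch. -/
theorem Inv.succ_of_nonempty {rigid : Bool} {δ : ℝ} {F : Fin n → Frame} (hn : 2 ≤ n)
    (he : e ∈ RSYNCH n) (h : Inv e K k t)
    (hK : Round .FCOM rigid δ F (e t) (K t) (K (t + 1))) (hg : (acting e K t).Nonempty) :
    Inv e K (k + 1) (t + 1) := by
  obtain ⟨-, h1, h2, h3, h4⟩ := round_effect hK h.stages (h.sees hn)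
  obtain ⟨h5, h6⟩ := h.counts_succ hn hK
  obtain ⟨r₀, hr₀⟩ := hg
  have hall := hr₀.2.stage_eq (h.sees hn r₀ hr₀.1)
  refine ⟨fun q => ?_, ?_, h5, h6⟩
  · by_cases hq : q ∈ e t
    · by_cases hq' : Ready (K t) q
      · exact Or.inr (Or.inl (h1 q hq hq').2)
      · exact Or.inl (h3 q hq hq').1
    · rw [(h4 q hq).1]
      exact Or.inl (hall q (by rintro rfl; exact hq hr₀.1))
  · by_cases hu : e t = Set.univ
    · left
      rcases h.isOver with ⟨h7, h8⟩ | ⟨q, hq, -⟩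
      · have hF : ∀ q, stage (K t) q = (k + 1, false) := by
          rcases h8 with h8 | h8
          · have : Nontrivial (Fin n) := Fin.nontrivial_iff_two_le.2 hn
            obtain ⟨q, hq⟩ := exists_ne r₀
            have := hall q hq
            rw [h8 q] at this
            simp at this
          · exact h8
        have hact : ∀ r, r ∈ acting e K t := fun r =>
          ⟨by rw [hu]; trivial, h.ready_of_le (fun s => (h7 r s).le) hF⟩
        refine ⟨fun r s => ?_, Or.inl fun q => (h1 q (hact q).1 (hact q).2).2⟩
        rw [acts_succ_of_mem (hact r), acts_succ_of_mem (hact s), h7 r s]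
      · exact absurd (hu ▸ trivial) hq
    · right
      refine ⟨r₀, fun hq' => ?_, Or.inl (h1 r₀ hr₀.1 hr₀.2).2⟩
      have : r₀ ∈ e t ∩ e (t + 1) := ⟨hr₀.1, hq'⟩
      rw [RSYNCH.inter_eq_empty he hu] at this
      exact this

/-- With `k = -1` the initial stage `(0, false)` belongs to epoch `k + 1`, and the initial sums 0
are correct because the initial state has code 0. -/
theorem inv_zero (hcode : code (A.off, 0) = 0)
    (hoff : ∀ r, (K 0).light r = (A.onBoard code).off) : Inv e K (-1) 0 := by
  have hstate : ∀ r, state (K 0) r = (A.off, 0) := fun r => by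
    unfold state; rw [hoff]; rfl
  have hstage : ∀ r, stage (K 0) r = (-1 + 1, false) := fun r => by
    unfold stage; rw [hoff]; rfl
  refine ⟨fun q => Or.inr (Or.inr ⟨hstage q, ?_⟩), Or.inl ⟨fun r s => ?_, Or.inr hstage⟩,
    fun r => ?_, fun r s => ?_⟩
  · simp only [sumOthers, hstate, hcode, Finset.sum_const_zero]
    unfold board; rw [hoff]; rfl
  · simp [acts]
  · simp [acts, hstate]
  · simp [acts]

theorem exists_inv {rigid : Bool} {δ : ℝ} {F : Fin n → Frame} (hn : 2 ≤ n) (he : e ∈ RSYNCH n)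
    (hcode : code (A.off, 0) = 0) (hoff : ∀ r, (K 0).light r = (A.onBoard code).off)
    (hK : ∀ t, Round .FCOM rigid δ F (e t) (K t) (K (t + 1))) (t : ℕ) : ∃ k, Inv e K k t := by
  induction t with
  | zero => exact ⟨_, inv_zero hcode hoff⟩
  | succ t ih =>
    obtain ⟨k, hk⟩ := ih
    by_cases hg : (acting e K t).Nonempty
    · exact ⟨_, hk.succ_of_nonempty hn he (hK t) hg⟩
    · exact ⟨_, (hk.succ_of_not_nonempty hn he (hK t) hg).1⟩

/-- If nobody acted any more, the epoch would stand still, all robots would in time reach stage `(k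
+ 1, false)`, and a robot with the fewest actions would be ready at its next activation. -/
theorem infinite_acting {rigid : Bool} {δ : ℝ} {F : Fin n → Frame} (hn : 2 ≤ n)
    (he : e ∈ RSYNCH n) (hcode : code (A.off, 0) = 0)
    (hoff : ∀ r, (K 0).light r = (A.onBoard code).off)
    (hK : ∀ t, Round .FCOM rigid δ F (e t) (K t) (K (t + 1))) :
    {t | (acting e K t).Nonempty}.Infinite := by
  refine Set.infinite_of_not_bddAbove fun ⟨T, hT⟩ => ?_
  have hno : ∀ t, T < t → ¬ (acting e K t).Nonempty := fun t ht hne =>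
    absurd (hT hne) (not_le.2 ht)
  obtain ⟨k, hk⟩ := exists_inv hn he hcode hoff hK (T + 1)
  have hinv : ∀ t, T + 1 ≤ t → Inv e K k t := fun t ht => by
    induction t, ht using Nat.le_induction with
    | base => exact hk
    | succ t ht ih => exact (ih.succ_of_not_nonempty hn he (hK t) (hno t ht)).1
  have hstage : ∀ r, ∀ᶠ t in Filter.atTop, stage (K t) r = (k + 1, false) := fun r => by
    obtain ⟨s, hs, hrs⟩ := he.1.1.exists_ge r (T + 1)
    rw [Filter.eventually_atTop]
    refine ⟨s + 1, fun t ht => ?_⟩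
    induction t, ht using Nat.le_induction with
    | base => exact ((hinv s hs).succ_of_not_nonempty hn he (hK s) (hno s hs)).2 r hrs
    | succ t ht ih =>
      have hi := hinv t (by omega)
      by_cases hr : r ∈ e t
      · exact (hi.succ_of_not_nonempty hn he (hK t) (hno t (by omega))).2 r hr
      · rw [((round_effect (hK t) hi.stages (hi.sees hn)).2.2.2.2 r hr).1, ih]
  obtain ⟨T', hT'⟩ := Filter.eventually_atTop.1 (Filter.eventually_all.2 hstage)
  have : Nonempty (Fin n) := ⟨⟨0, by omega⟩⟩
  obtain ⟨r, hr⟩ := Finite.exists_min (acts (acting e K) (max (T + 1) T'))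
  have hconst : ∀ t, max (T + 1) T' ≤ t →
      acts (acting e K) t = acts (acting e K) (max (T + 1) T') := fun t ht => by
    induction t, ht using Nat.le_induction with
    | base => rfl
    | succ t ht ih =>
      rw [← ih]
      funext s
      exact acts_succ_of_notMem fun hs => hno t (by omega) ⟨s, hs⟩
  obtain ⟨s, hs, hrs⟩ := he.1.1.exists_ge r (max (T + 1) T')
  refine hno s (by omega) ⟨r, hrs, (hinv s (by omega)).ready_of_le ?_ (hT' s (by omega))⟩
  rw [hconst s hs]
  exact hr

end OnBoard

/-- Any bijection with a cyclic group of the right order, translated so that `s₀` has code 0. -/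
theorem exists_code (S : Type) [Finite S] (s₀ : S) :
    ∃ (N : ℕ) (code : S ≃ ZMod N), code s₀ = 0 := by
  have : Nonempty S := ⟨s₀⟩
  have : NeZero (Nat.card S) := ⟨Nat.card_pos.ne'⟩
  let f : S ≃ ZMod (Nat.card S) :=
    (Finite.equivFin S).trans (ZMod.finEquiv (Nat.card S)).toEquiv
  exact ⟨Nat.card S, f.trans (Equiv.subRight (f s₀)), by simp⟩

theorem fcom_RSYNCH_notLessPowerful_lumi_SSYNCH :
    NotLessPowerful .FCOM RSYNCH .LUMI SSYNCH := by
  rintro R P ⟨A, hA⟩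
  have := A.finite_idx
  have := A.finite_color
  obtain ⟨N, code, hcode⟩ := exists_code (A.Light × ZMod 3) (A.off, 0)
  refine ⟨A.onBoard code, fun F hF δ hδ e he K h0 hoff hK => ?_⟩
  have hinf := OnBoard.infinite_acting R.two_le he hcode hoff hK
  have hinv := OnBoard.exists_inv R.two_le he hcode hoff hK
  refine valid_of_simulation hA hF hδ hinf (compress_mem_SSYNCH R.two_le
    (infinite_of_acts_le 1 (fun t => (hinv t).choose_spec.le) hinf))
    (L := fun t => OnBoard.sim (K t)) h0 (fun r => ?_) fun t => ?_
  · simp only [OnBoard.sim, OnBoard.state, hoff]; rfl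
  · obtain ⟨k, hk⟩ := hinv t
    exact (OnBoard.round_effect (hK t) hk.stages (hk.sees R.two_le)).1

/-! ### Rigid teams without any agreement on the coordinate systems -/

/-- Disoriented robots with rigid movements. -/
def disoriented (n : ℕ) (hn : 2 ≤ n) : Team where
  n := n
  two_le := hn
  rigid := true
  frames := Set.univ
  frames_nonempty := ⟨fun _ => ⟨1, one_ne_zero, false⟩, trivial⟩
  global_unknown _ _ _ _ _ := trivial
  identical _ _ _ := trivial

/-- The global coordinate system as a local one. -/
def Frame.one : Frame := ⟨1, one_ne_zero, false⟩

theorem Frame.toGlobal_one (v : ℂ) : Frame.one.toGlobal v = v := by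
  simp [Frame.one, Frame.toGlobal]

theorem Frame.toLocal_one (v : ℂ) : Frame.one.toLocal v = v := by
  simp [Frame.one, Frame.toLocal]

section Run

variable {A : Algorithm} {n : ℕ}

open Classical in
/-- The execution with rigid movements and the global coordinate system for all robots. -/
noncomputable def run (M : Model) (e : ActivationSeq n) (K : Config A n) : ℕ → Config A n
  | 0 => K
  | t + 1 =>
    let K' := run M e K t
    { pos := fun r =>
        if r ∈ e t then K'.pos r + (output M (fun _ => Frame.one) K' r).2 else K'.pos r
      light := fun r => if r ∈ e t then
        fun i => ((output M (fun _ => Frame.one) K' r).1 i).getD (K'.light r i) else K'.light r }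

theorem round_run (M : Model) (δ : ℝ) (e : ActivationSeq n) (K : Config A n) (t : ℕ) :
    Round M true δ (fun _ => Frame.one) (e t) (run M e K t) (run M e K (t + 1)) := by
  intro r
  constructor
  · intro hr; simp [run, hr]
  · intro hr; simp [run, hr, Moves, Frame.toGlobal_one]

/-- All lights are off. -/
def start (A : Algorithm) (x : Fin n → ℂ) : Config A n := ⟨x, fun _ => A.off⟩

theorem Solves.run_valid {M : Model} {S : Scheduler} {hn : 2 ≤ n} {P : Problem n}
    (h : Solves M S (disoriented n hn) A P) {e : ActivationSeq n} (he : e ∈ S n)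
    {x : Fin n → ℂ} (hx : x ∈ P.init) : (fun t => (run M e (start A x) t).pos) ∈ P.valid :=
  h (fun _ => Frame.one) trivial 1 one_pos e he (run M e (start A x)) hx (fun _ => rfl)
    (round_run M 1 e _)

end Run

/-! ### Memory helps: moving, but not forever -/

theorem map_zero_of_surjective {f : ℕ → ℕ} (hf : Monotone f) (hs : Function.Surjective f) :
    f 0 = 0 := by
  obtain ⟨x, hx⟩ := hs 0
  have := hf (Nat.zero_le x)
  omega

/-- The robots have to change their placement, but only finitely often. -/
def moveAndStop (n : ℕ) : Problem n where
  init := Set.univ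
  valid := {σ | (∃ t, σ t ≠ σ 0) ∧ ∃ T, ∀ t, T ≤ t → σ t = σ T}
  stutter σ f hf hs := by
    have h0 := map_zero_of_surjective hf hs
    constructor
    · rintro ⟨⟨t, ht⟩, T, hT⟩
      refine ⟨⟨f t, by simpa [h0] using ht⟩, f T, fun s hs' => ?_⟩
      obtain ⟨t, rfl⟩ := hs s
      rcases le_total T t with h | h
      · exact hT t h
      · rw [le_antisymm hs' (hf h)]
    · rintro ⟨⟨t, ht⟩, T, hT⟩
      obtain ⟨u, rfl⟩ := hs t
      obtain ⟨v, rfl⟩ := hs T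
      exact ⟨⟨u, by simpa [h0] using ht⟩, v, fun t ht => hT _ (hf ht)⟩

open Classical in
/-- Every robot moves once. -/
noncomputable def moveOnce : Algorithm where
  Idx := Unit
  finite_idx := inferInstance
  Color _ := Bool
  finite_color _ := inferInstance
  off _ := false
  compute own _ := if own = some fun _ => true then (fun _ => none, 0) else (fun _ => some true, 1)

theorem moveOnce_solves {n : ℕ} (hn : 2 ≤ n) :
    Solves .FSTA RSYNCH (disoriented n hn) moveOnce (moveAndStop n) := by
  intro F _ δ _ e he K _ hoff hK
  have hout : ∀ t r, (K t).light r () = true → output .FSTA F (K t) r = (fun _ => none, 0) :=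
    fun t r hl => if_pos (congrArg some (funext fun _ => hl))
  have hout' : ∀ t r, ¬ (K t).light r () = true →
      output .FSTA F (K t) r = (fun _ => some true, 1) :=
    fun t r hl => if_neg fun h => hl (congrFun (Option.some.inj h) ())
  have hon : ∀ t r, (K t).light r () = true →
      (K (t + 1)).light r () = true ∧ (K (t + 1)).pos r = (K t).pos r := by
    intro t r hl
    by_cases hr : r ∈ e t
    · obtain ⟨h1, h2⟩ := (hK t r).2 hr
      rw [hout t r hl] at h1 h2
      simp only [Frame.toGlobal_zero, add_zero] at h1
      exact ⟨(h2 ()).trans hl, h1.eq_of_stay⟩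
    · obtain ⟨h1, h2⟩ := (hK t r).1 hr
      exact ⟨by rw [h2]; exact hl, h1⟩
  have hact : ∀ t r, r ∈ e t → (K (t + 1)).light r () = true := by
    intro t r hr
    by_cases hl : (K t).light r () = true
    · exact (hon t r hl).1
    · have h2 := ((hK t r).2 hr).2 ()
      rw [hout' t r hl] at h2
      exact h2
  constructor
  -- A robot active in round 0 leaves its place, since the local vector 1 is nonzero in global
  -- coordinates too.
  · obtain ⟨r, hr⟩ := he.1.2 0
    refine ⟨1, fun h => ?_⟩
    have h1 := ((hK 0 r).2 hr).1
    have hl : ¬ (K 0).light r () = true := by rw [hoff]; simp [moveOnce]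
    rw [hout' 0 r hl] at h1
    have h2 : (K 1).pos r = (K 0).pos r := congrFun h r
    have h3 : (K 1).pos r = (K 0).pos r + (F r).toGlobal 1 := h1
    rw [h2] at h3
    have h4 : (F r).toGlobal 1 = 0 := by simpa using h3.symm
    have h5 := (F r).toLocal_toGlobal 1
    rw [h4] at h5
    simp [Frame.toLocal] at h5
  · have hev : ∀ r, ∀ᶠ t in Filter.atTop, (K t).light r () = true := fun r => by
      obtain ⟨s, -, hs⟩ := he.1.1.exists_ge r 0
      rw [Filter.eventually_atTop]
      refine ⟨s + 1, fun t ht => ?_⟩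
      induction t, ht using Nat.le_induction with
      | base => exact hact s r hs
      | succ t ht ih => exact (hon t r ih).1
    obtain ⟨T, hT⟩ := Filter.eventually_atTop.1 (Filter.eventually_all.2 hev)
    refine ⟨T, fun t ht => ?_⟩
    induction t, ht using Nat.le_induction with
    | base => rfl
    | succ t ht ih => exact (funext fun r => (hon t r (hT t ht r)).2).trans ih

theorem univ_mem_RSYNCH {n : ℕ} (hn : 2 ≤ n) : (fun _ => Set.univ) ∈ RSYNCH n :=
  ⟨⟨⟨fun _ => ⟨0, trivial⟩, fun _ i _ => ⟨i + 1, by omega, trivial⟩⟩,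
    fun _ => ⟨⟨0, by omega⟩, trivial⟩⟩, Or.inl fun _ => rfl⟩

/-- Gathered oblivious robots always see the same, so that they never stop once they move. -/
theorem moveAndStop_notMem_oblot {n : ℕ} (hn : 2 ≤ n) :
    moveAndStop n ∉ Task .OBLOT RSYNCH (disoriented n hn) := by
  rintro ⟨A, hA⟩
  -- The move of a gathered robot. With equal frames and full rounds all robots make it, so they
  -- stay gathered.
  set v := (A.compute none (Multiset.replicate (n - 1) (0, none))).2 with hv
  have hpos : ∀ t, (run .OBLOT (fun _ => Set.univ) (start (n := n) A fun _ => 0) t).pos =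
      fun _ => (t : ℂ) * v := by
    intro t
    induction t with
    | zero => funext r; simp [run, start]
    | succ t ih =>
      funext r
      have : output .OBLOT (fun _ => Frame.one)
          (run .OBLOT (fun _ => Set.univ) (start (n := n) A fun _ => 0) t) r =
          A.compute none (Multiset.replicate (n - 1) (0, none)) := by
        simp only [output, snapshot, Model.seesOwn, Model.seesOthers, ih, sub_self,
          Frame.toLocal_one]
        simp
      simp only [run, Set.mem_univ, if_true, this, ih, ← hv]
      push_cast
      ring
  obtain ⟨⟨t, ht⟩, T, hT⟩ := hA.run_valid (univ_mem_RSYNCH hn) (x := fun _ => 0) trivial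
  have h1 := congrFun (hT (T + 1) (by omega)) ⟨0, by omega⟩
  simp only [hpos] at h1 ht
  push_cast at h1
  have h2 : v = 0 := by linear_combination h1
  simp [h2] at ht

/-! ### Communication helps: passing on what only one robot has seen

Three robots `0`, `1`, `2` are on a line. Robot `1` moves first, to a place that does not depend
on where it came from. Then robot `0` has to move to a place that does. -/

namespace Relay

/-- The two possible places of robot `1` in the beginning. -/
def src : Bool → ℝ
  | true => 3
  | false => 4

/-- The corresponding final places of robot `0`, up to sign. -/
def dst : Bool → ℝ
  | true => 1
  | false => 2

/-- The placement in the beginning. -/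
def first (j : Bool) : Fin 3 → ℂ := ![0, (src j : ℂ), 1]

/-- The placement after the move of robot `1`. -/
def middle : Fin 3 → ℂ := ![0, 5, 1]

/-- The placement in the end. -/
def last (j : Bool) : Fin 3 → ℂ := ![-(dst j : ℂ), 5, 1]

theorem src_ne_five (j : Bool) : (src j : ℂ) ≠ 5 := by
  cases j <;> norm_num [src]

theorem dst_ne_zero (j : Bool) : (dst j : ℂ) ≠ 0 := by
  cases j <;> norm_num [dst]

theorem src_injective {j j' : Bool} (h : (src j : ℂ) = src j') : j = j' := by
  cases j <;> cases j' <;> first | rfl | norm_num [src] at h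

theorem dst_injective {j j' : Bool} (h : (dst j : ℂ) = dst j') : j = j' := by
  cases j <;> cases j' <;> first | rfl | norm_num [dst] at h

theorem first_ne_middle (j : Bool) : first j ≠ middle := fun h =>
  src_ne_five j (congrFun h 1)

theorem first_ne_last (j j' : Bool) : first j ≠ last j' := fun h =>
  src_ne_five j (congrFun h 1)

theorem middle_ne_last (j : Bool) : middle ≠ last j := fun h =>
  dst_ne_zero j (by simpa [middle, last] using congrFun h 0)

theorem first_injective {j j' : Bool} (h : first j = first j') : j = j' :=
  src_injective (congrFun h 1)

/-- The valid sequences that begin with `first j`. -/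
structure ValidFrom (j : Bool) (σ : ℕ → Fin 3 → ℂ) : Prop where
  zero : σ 0 = first j
  range : ∀ t, σ t = first j ∨ σ t = middle ∨ σ t = last j
  order : ∀ t t', t ≤ t' → σ t = middle → σ t' = middle ∨ σ t' = last j
  limit : ∃ T, ∀ t, T ≤ t → σ t = last j

/-- Robot `1` moves first, then robot `0`. -/
def problem : Problem 3 where
  init := Set.range first
  valid := {σ | ∃ j, ValidFrom j σ}
  stutter σ f hf hs := by
    have h0 := map_zero_of_surjective hf hs
    refine exists_congr fun j => ⟨fun h => ?_, fun h => ?_⟩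
    · refine ⟨by simpa [h0] using h.zero, fun t => ?_, fun t t' htt' ht => ?_, ?_⟩
      · obtain ⟨u, rfl⟩ := hs t
        exact h.range u
      · obtain ⟨u, rfl⟩ := hs t
        obtain ⟨u', rfl⟩ := hs t'
        rcases le_total u u' with hu | hu
        · exact h.order u u' hu ht
        · rw [← le_antisymm htt' (hf hu)]
          exact Or.inl ht
      · obtain ⟨T, hT⟩ := h.limit
        refine ⟨f T, fun t ht => ?_⟩
        obtain ⟨u, rfl⟩ := hs t
        rcases le_total T u with hu | hu
        · exact hT u hu
        · rw [← le_antisymm ht (hf hu)]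
          exact hT T le_rfl
    · refine ⟨by simpa [h0] using h.zero, fun t => h.range _,
        fun t t' htt' ht => h.order _ _ (hf htt') ht, ?_⟩
      obtain ⟨T, hT⟩ := h.limit
      obtain ⟨u, rfl⟩ := hs T
      exact ⟨u, fun t ht => hT _ (hf ht)⟩

/-! #### Robots that do not see the lights of the others -/

section FSTA

variable (A : Algorithm)

/-- What robot `x` of the placement `Z` sees if it does not see the lights of the others. -/
noncomputable def view {n : ℕ} (Z : Fin n → ℂ) (x : Fin n) : Multiset (ℂ × Option A.Light) :=
  (Finset.univ.erase x).val.map fun s => (Frame.one.toLocal (Z s - Z x), none)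

/-- The lights of a robot that has seen the same view `V` in each of `m` activations. -/
noncomputable def lightAfter (V : Multiset (ℂ × Option A.Light)) : ℕ → A.Light
  | 0 => A.off
  | m + 1 => fun i => ((A.compute (some (lightAfter V m)) V).1 i).getD (lightAfter V m i)

/-- The next move of this robot. -/
noncomputable def moveAfter (V : Multiset (ℂ × Option A.Light)) (m : ℕ) : ℂ :=
  (A.compute (some (lightAfter A V m)) V).2

variable {A} {n : ℕ} {δ : ℝ} {e : ActivationSeq n} {K : ℕ → Config A n} {Z : Fin n → ℂ} {x : Fin n}

theorem effect_of_mem (hK : ∀ t, Round .FSTA true δ (fun _ => Frame.one) (e t) (K t) (K (t + 1)))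
    {t m : ℕ} (hZ : (K t).pos = Z) (hl : (K t).light x = lightAfter A (view A Z x) m)
    (hx : x ∈ e t) : (K (t + 1)).pos x = Z x + moveAfter A (view A Z x) m ∧
      (K (t + 1)).light x = lightAfter A (view A Z x) (m + 1) := by
  obtain ⟨h1, h2⟩ := (hK t x).2 hx
  have hout : output .FSTA (fun _ => Frame.one) (K t) x =
      A.compute (some (lightAfter A (view A Z x) m)) (view A Z x) := by
    rw [← hl, ← hZ]; rfl
  rw [hout, Frame.toGlobal_one, hZ] at h1
  rw [hout, hl] at h2
  exact ⟨h1, funext h2⟩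

/-- Until `x` moves, its lights only depend on the number of its activations. -/
theorem persist (hK : ∀ t, Round .FSTA true δ (fun _ => Frame.one) (e t) (K t) (K (t + 1)))
    (h0 : (K 0).pos = Z) (hl : (K 0).light x = A.off)
    (hZ : ∀ t, (K t).pos = Z → (K (t + 1)).pos x = Z x → (K (t + 1)).pos = Z) (t : ℕ)
    (hm : ∀ i, i < acts e t x → moveAfter A (view A Z x) i = 0) :
    (K t).pos = Z ∧ (K t).light x = lightAfter A (view A Z x) (acts e t x) := by
  induction t with
  | zero => exact ⟨h0, by rw [hl]; simp [acts, lightAfter]⟩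
  | succ t ih =>
    by_cases hx : x ∈ e t
    · rw [acts_succ_of_mem hx] at hm ⊢
      obtain ⟨h1, h2⟩ := ih fun i hi => hm i (by omega)
      obtain ⟨h3, h4⟩ := effect_of_mem hK h1 h2 hx
      rw [hm _ (by omega), add_zero] at h3
      exact ⟨hZ t h1 h3, h4⟩
    · rw [acts_succ_of_notMem hx] at hm ⊢
      obtain ⟨h1, h2⟩ := ih hm
      obtain ⟨h3, h4⟩ := (hK t x).1 hx
      exact ⟨hZ t h1 (by rw [h3, h1]), by rw [h4, h2]⟩

theorem singleton_mem_RSYNCH {n : ℕ} {c : ℕ → Fin n} (h : ∀ t, c t ≠ c (t + 1))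
    (hf : ∀ r i, ∃ j, i < j ∧ c j = r) : (fun t => {c t}) ∈ RSYNCH n := by
  have hne : ∀ t, ({c t} : Set (Fin n)) ≠ Set.univ := fun t hu => by
    have : c (t + 1) ∈ ({c t} : Set (Fin n)) := by rw [hu]; trivial
    exact h t this.symm
  refine ⟨⟨⟨fun r => ?_, fun r i _ => ?_⟩, fun t => ⟨c t, rfl⟩⟩,
    Or.inr ⟨0, fun i hi => absurd hi (by omega), fun i _ => ⟨⟨c i, rfl⟩, hne i, ?_⟩⟩⟩
  · obtain ⟨j, -, hj⟩ := hf r 0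
    exact ⟨j, hj.symm⟩
  · obtain ⟨j, hij, hj⟩ := hf r i
    exact ⟨j, hij, hj.symm⟩
  · refine Set.eq_empty_of_forall_notMem fun r ⟨h1, h2⟩ => ?_
    exact h i (h1.symm.trans h2)

/-- For `N` rounds robots `1` and `2` are active in turns, then all robots. -/
def turns (N t : ℕ) : Fin 3 :=
  if t < N then (if t % 2 = 0 then 1 else 2) else ⟨(t - N) % 3, Nat.mod_lt _ (by omega)⟩

theorem turns_add (N t : ℕ) : turns N (N + t) = ⟨t % 3, Nat.mod_lt _ (by omega)⟩ := by
  simp [turns]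

theorem turns_mem_RSYNCH (N : ℕ) : (fun t => {turns N t}) ∈ RSYNCH 3 := by
  refine singleton_mem_RSYNCH (fun t => ?_) fun r i => ?_
  · unfold turns
    split_ifs <;> simp [Fin.ext_iff] <;> omega
  · refine ⟨N + (3 * (i + 1) + r), by omega, ?_⟩
    rw [turns_add]
    ext
    simp only
    omega

theorem acts_turns {N i : ℕ} (hi : 2 * i ≤ N) : acts (fun t => {turns N t}) (2 * i) 1 = i := by
  induction i with
  | zero => simp [acts]
  | succ i ih =>
    have h1 : (1 : Fin 3) ∈ ({turns N (2 * i)} : Set (Fin 3)) := by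
      simp [turns, show 2 * i < N by omega]
    have h2 : (1 : Fin 3) ∉ ({turns N (2 * i + 1)} : Set (Fin 3)) := by
      simp [turns, show 2 * i + 1 < N by omega]
    have := acts_succ_of_notMem (g := fun t => {turns N t}) h2
    rw [show 2 * (i + 1) = 2 * i + 1 + 1 by ring, this,
      acts_succ_of_mem (g := fun t => {turns N t}) h1, ih (by omega)]

theorem run_validFrom {A : Algorithm}
    (hA : Solves .FSTA RSYNCH (disoriented 3 (by omega)) A problem)
    {e : ActivationSeq 3} (he : e ∈ RSYNCH 3) (j : Bool) :
    ValidFrom j fun t => (run .FSTA e (start A (first j)) t).pos := by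
  obtain ⟨j', hj'⟩ := hA.run_valid he (x := first j) ⟨j, rfl⟩
  obtain rfl : j = j' := first_injective hj'.zero
  exact hj'

/-- Robot `1` alone tells the first placement from the two others; below, robot `0` alone tells the
middle from the last one. -/
theorem ValidFrom.stay_first {j : Bool} {σ : ℕ → Fin 3 → ℂ} (h : ValidFrom j σ) {t : ℕ}
    (ht : σ t 1 = first j 1) : σ t = first j := by
  rcases h.range t with h1 | h1 | h1
  · exact h1
  · rw [h1] at ht
    exact absurd ht.symm (src_ne_five j)
  · rw [h1] at ht
    exact absurd ht.symm (src_ne_five j)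

theorem ValidFrom.stay_middle {j : Bool} {σ : ℕ → Fin 3 → ℂ} (h : ValidFrom j σ) {s t : ℕ}
    (hst : s ≤ t) (hs : σ s = middle) (ht : σ t 0 = middle 0) : σ t = middle := by
  rcases h.order s t hst hs with h1 | h1
  · exact h1
  · rw [h1] at ht
    exact absurd (by simpa [last, middle] using ht) (dst_ne_zero j)

/-- Robot `1` moves after some number of activations. -/
theorem exists_moveAfter_first {A : Algorithm}
    (hA : Solves .FSTA RSYNCH (disoriented 3 (by omega)) A problem) (j : Bool) :
    ∃ m, moveAfter A (view A (first j) 1) m ≠ 0 := by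
  by_contra hc
  push Not at hc
  have hv := run_validFrom hA (turns_mem_RSYNCH 0) j
  obtain ⟨T, hT⟩ := hv.limit
  have := (persist (round_run .FSTA 1 _ _) rfl rfl
    (fun t _ ht => hv.stay_first (t := t + 1) ht) T fun i _ => hc i).1
  exact first_ne_last j j (this.symm.trans (hT T le_rfl))

/-- Robot `0`, which has not seen the beginning, makes the right move. -/
theorem exists_moveAfter_middle {A : Algorithm}
    (hA : Solves .FSTA RSYNCH (disoriented 3 (by omega)) A problem) (j : Bool) :
    ∃ m, (∀ i, i < m → moveAfter A (view A middle 0) i = 0) ∧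
      moveAfter A (view A middle 0) m = -(dst j : ℂ) := by
  classical
  have hex := exists_moveAfter_first hA j
  set m := Nat.find hex with hm
  -- Robot `1` is active in the even rounds, so its first proper move, after `m` activations, occurs
  -- in round `2 * m`, the last one before robot `0` is activated for the first time.
  have he := turns_mem_RSYNCH (2 * m + 1)
  have hv := run_validFrom hA he j
  set e : ActivationSeq 3 := fun t => {turns (2 * m + 1) t} with he'
  set K := run .FSTA e (start A (first j)) with hKdef
  have hK : ∀ t, Round .FSTA true 1 (fun _ => Frame.one) (e t) (K t) (K (t + 1)) :=
    round_run .FSTA 1 _ _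
  have hacts : acts e (2 * m) 1 = m := acts_turns (by omega)
  have hidle : ∀ t, t ≤ 2 * m + 1 → (K t).light 0 = A.off ∧ (K t).pos 0 = 0 := by
    intro t ht
    induction t with
    | zero => exact ⟨rfl, rfl⟩
    | succ t ih =>
      have h0 : (0 : Fin 3) ∉ e t := by
        simp only [he', turns, if_pos (show t < 2 * m + 1 by omega), Set.mem_singleton_iff]
        split_ifs <;> decide
      obtain ⟨h1, h2⟩ := (hK t 0).1 h0
      rw [h1, h2]
      exact ih (by omega)
  have hmid : (K (2 * m + 1)).pos = middle := by
    obtain ⟨h1, h2⟩ := persist (Z := first j) (x := 1) hK rfl rfl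
      (fun t _ ht => hv.stay_first (t := t + 1) ht) (2 * m) fun i hi => by
        rw [hacts] at hi
        simpa using Nat.find_min hex hi
    rw [hacts] at h2
    have h3 := (effect_of_mem hK h1 h2 (by simp [he', turns])).1
    have h4 := Nat.find_spec hex
    -- Robot `1` has moved and robot `0` has not, which leaves only the middle placement.
    rcases hv.range (2 * m + 1) with h5 | h5 | h5
    · have h6 : first j 1 = first j 1 + moveAfter A (view A (first j) 1) m :=
        (congrFun h5 1).symm.trans h3
      exact absurd (by simpa using h6) h4
    · exact h5
    · have h6 := (hidle (2 * m + 1) le_rfl).2.symm.trans (congrFun h5 0)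
      exact absurd (by simpa [last] using h6) (dst_ne_zero j)
  -- The execution is restarted here: robot `0` still has its initial lights, so nothing it knows
  -- depends on `j`.
  have hK' : ∀ t, Round .FSTA true 1 (fun _ => Frame.one) (e (2 * m + 1 + t))
      (K (2 * m + 1 + t)) (K (2 * m + 1 + (t + 1))) := fun t => hK (2 * m + 1 + t)
  have hpersist := persist (x := 0) (e := fun t => e (2 * m + 1 + t))
    (K := fun t => K (2 * m + 1 + t)) hK' hmid (hidle _ le_rfl).1
    (fun t ht ht' => hv.stay_middle (s := 2 * m + 1 + t) (by omega) ht ht')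
  have hex' : ∃ i, moveAfter A (view A middle 0) i ≠ 0 := by
    by_contra hc
    push Not at hc
    obtain ⟨T, hT⟩ := hv.limit
    exact middle_ne_last j ((hpersist T fun i _ => hc i).1.symm.trans
      (hT (2 * m + 1 + T) (by omega)))
  have hinf : {t | (0 : Fin 3) ∈ e (2 * m + 1 + t)}.Infinite := by
    refine Set.infinite_of_not_bddAbove fun ⟨B, hB⟩ => ?_
    have : 3 * (B + 1) ≤ B := hB (by
      change (0 : Fin 3) = turns _ _
      rw [turns_add]
      ext
      simp)
    omega
  have hact : acts (fun t => e (2 * m + 1 + t))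
      (Nat.nth (fun t => (0 : Fin 3) ∈ e (2 * m + 1 + t)) (Nat.find hex')) 0 = Nat.find hex' := by
    unfold acts
    convert Nat.count_nth_of_infinite hinf (Nat.find hex')
  have hmem : (0 : Fin 3) ∈ e (2 * m + 1 +
      Nat.nth (fun t => (0 : Fin 3) ∈ e (2 * m + 1 + t)) (Nat.find hex')) :=
    Nat.nth_mem_of_infinite hinf (Nat.find hex')
  set t₀ := Nat.nth (fun t => (0 : Fin 3) ∈ e (2 * m + 1 + t)) (Nat.find hex')
  have hmin : ∀ i, i < Nat.find hex' → moveAfter A (view A middle 0) i = 0 := fun i hi => by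
    simpa using Nat.find_min hex' hi
  obtain ⟨h1, h2⟩ := hpersist t₀ fun i hi => hmin i (by rwa [hact] at hi)
  rw [hact] at h2
  have h3 := (effect_of_mem hK h1 h2 hmem).1
  refine ⟨Nat.find hex', hmin, ?_⟩
  rcases hv.order _ (2 * m + 1 + t₀ + 1) (by omega) h1 with h4 | h4
  · have h5 : middle 0 = middle 0 + moveAfter A (view A middle 0) (Nat.find hex') :=
      (congrFun h4 0).symm.trans h3
    exact absurd (by simpa using h5) (Nat.find_spec hex')
  · have h5 : last j 0 = middle 0 + moveAfter A (view A middle 0) (Nat.find hex') :=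
      (congrFun h4 0).symm.trans h3
    simpa [last, middle] using h5.symm

/-- The moves of robot `0` in the middle placement form one sequence independent of `j`, yet its
first nonzero entry would have to be `-dst j` for both values of `j`. -/
theorem problem_notMem_fsta : problem ∉ Task .FSTA RSYNCH (disoriented 3 (by omega)) := by
  rintro ⟨A, hA⟩
  obtain ⟨m, h1, h2⟩ := exists_moveAfter_middle hA true
  obtain ⟨m', h1', h2'⟩ := exists_moveAfter_middle hA false
  have hmm : m = m' := by
    rcases lt_trichotomy m m' with h | h | h
    · rw [h1' m h] at h2
      exact absurd (by simpa using h2.symm) (dst_ne_zero true)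
    · exact h
    · rw [h1 m' h] at h2'
      exact absurd (by simpa using h2'.symm) (dst_ne_zero false)
  subst hmm
  exact absurd (dst_injective (neg_injective (h2.symm.trans h2'))) (by decide)

end FSTA

/-! #### Robots that see all lights -/

/-- The colors: initially `none`; robot `1` sets its light to `some (some j)` if it has started
from `src j`, robot `0` sets its light to `some none` when it has moved. -/
abbrev Color : Type := Option (Option Bool)

theorem pair_eq_pair {α : Type*} {a b c d : α} (h : ({a, b} : Multiset α) = {c, d}) :
    (a = c ∧ b = d) ∨ (a = d ∧ b = c) := by
  have ha : a ∈ ({c, d} : Multiset α) := by rw [← h]; simp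
  rw [Multiset.insert_eq_cons, Multiset.mem_cons, Multiset.mem_singleton] at ha
  rcases ha with rfl | rfl
  · left
    simpa [Multiset.insert_eq_cons] using h
  · right
    rw [Multiset.pair_comm c] at h
    simpa [Multiset.insert_eq_cons] using h

/-- What robot `1` sees in the beginning, if it starts from `src x.1`; the local vector from
robot `0` to robot `2` is `x.2`. -/
noncomputable def sightOne (x : Bool × ℂ) : Multiset (ℂ × Option Color) :=
  {(-(src x.1 : ℂ) * x.2, some none), ((1 - (src x.1 : ℂ)) * x.2, some none)}

/-- What robot `0` sees after the move of robot `1`. -/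
noncomputable def sightZero (x : Bool × ℂ) : Multiset (ℂ × Option Color) :=
  {(5 * x.2, some (some (some x.1))), (x.2, some none)}

open Classical in
/-- What a robot does whose light has the color `own`, and that sees `W`. -/
noncomputable def react (own : Option Color) (W : Multiset (ℂ × Option Color)) :
    Option Color × ℂ :=
  if h : own = some none ∧ ∃ x, x.2 ≠ 0 ∧ W = sightOne x then
    (some (some (some h.2.choose.1)), (5 - (src h.2.choose.1 : ℂ)) * h.2.choose.2)
  else if h : own = some none ∧ ∃ x, x.2 ≠ 0 ∧ W = sightZero x then
    (some (some none), -(dst h.2.choose.1 : ℂ) * h.2.choose.2)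
  else (none, 0)

/-- The algorithm for robots that see all lights. -/
noncomputable def algorithm : Algorithm where
  Idx := Unit
  finite_idx := inferInstance
  Color _ := Color
  finite_color _ := inferInstance
  off _ := none
  compute own V :=
    let out := react (own.map (· ())) (V.map fun v => (v.1, v.2.map (· ())))
    (fun _ => out.1, out.2)

/-- Matching the two seen robots crosswise would require `src j + src k = 1`. -/
theorem sightOne_injective {x y : Bool × ℂ} (hx : x.2 ≠ 0) (h : sightOne x = sightOne y) :
    x = y := by
  obtain ⟨j, z⟩ := x
  obtain ⟨k, w⟩ := y
  simp only [ne_eq] at hx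
  rcases pair_eq_pair h with ⟨h1, h2⟩ | ⟨h1, h2⟩ <;> simp only [Prod.mk.injEq, and_true] at h1 h2
  · have hz : z = w := by linear_combination h2 - h1
    subst hz
    have := src_injective (mul_right_cancel₀ hx (by linear_combination -h1 :
      (src j : ℂ) * z = src k * z))
    rw [this]
  · have hz : w = -z := by linear_combination h2 - h1
    subst hz
    have h3 : ((src j : ℂ) + src k - 1) * z = 0 := by linear_combination -h1
    rcases mul_eq_zero.1 h3 with h4 | h4
    · cases j <;> cases k <;> norm_num [src] at h4
    · exact absurd h4 hx

theorem sightZero_injective {x y : Bool × ℂ} (h : sightZero x = sightZero y) : x = y := by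
  rcases pair_eq_pair h with ⟨h1, h2⟩ | ⟨h1, h2⟩ <;> simp at h1 h2
  exact Prod.ext h1.2 h2

theorem sightZero_ne_sightOne (x y : Bool × ℂ) : sightZero x ≠ sightOne y := fun h => by
  rcases pair_eq_pair h with ⟨h1, -⟩ | ⟨h1, -⟩ <;> simp at h1

theorem react_sightOne {x : Bool × ℂ} (hx : x.2 ≠ 0) : react (some none) (sightOne x) =
    (some (some (some x.1)), (5 - (src x.1 : ℂ)) * x.2) := by
  have h : some (none : Option (Option Bool)) = some none ∧
      ∃ y : Bool × ℂ, y.2 ≠ 0 ∧ sightOne x = sightOne y := ⟨rfl, x, hx, rfl⟩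
  have h2 := sightOne_injective hx h.2.choose_spec.2
  rw [react, dif_pos h, ← h2]

theorem react_sightZero {x : Bool × ℂ} (hx : x.2 ≠ 0) : react (some none) (sightZero x) =
    (some (some none), -(dst x.1 : ℂ) * x.2) := by
  have h0 : ¬ (some (none : Option (Option Bool)) = some none ∧
      ∃ y : Bool × ℂ, y.2 ≠ 0 ∧ sightZero x = sightOne y) :=
    fun h => sightZero_ne_sightOne _ _ h.2.choose_spec.2
  have h : some (none : Option (Option Bool)) = some none ∧
      ∃ y : Bool × ℂ, y.2 ≠ 0 ∧ sightZero x = sightZero y := ⟨rfl, x, hx, rfl⟩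
  have h2 := sightZero_injective h.2.choose_spec.2
  rw [react, dif_neg h0, dif_pos h, ← h2]

theorem react_of_ne {own : Option Color} {W : Multiset (ℂ × Option Color)}
    (h1 : ∀ x : Bool × ℂ, x.2 ≠ 0 → W ≠ sightOne x)
    (h2 : ∀ x : Bool × ℂ, x.2 ≠ 0 → W ≠ sightZero x) : react own W = (none, 0) := by
  rw [react, dif_neg, dif_neg]
  · rintro ⟨-, x, hx, h⟩; exact h2 x hx h
  · rintro ⟨-, x, hx, h⟩; exact h1 x hx h

theorem react_of_on {c : Option Bool} {W : Multiset (ℂ × Option Color)} :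
    react (some (some c)) W = (none, 0) := by
  simp [react]

/-- The stages of the execution. -/
noncomputable def stageConfig (j : Bool) : Fin 3 → Config algorithm 3
  | 0 => ⟨first j, fun _ _ => none⟩
  | 1 => ⟨middle, fun r _ => (![none, some (some j), none] : Fin 3 → Color) r⟩
  | 2 => ⟨last j, fun r _ => (![some none, some (some j), none] : Fin 3 → Color) r⟩

/-- What robot `r` does. -/
noncomputable def reaction (F : Fin 3 → Frame) (K : Config algorithm 3) (r : Fin 3) :
    Option Color × ℂ :=
  react (some (K.light r ())) ((Finset.univ.erase r).val.map fun s =>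
    ((F r).toLocal (K.pos s - K.pos r), some (K.light s ())))

theorem output_algorithm (F : Fin 3 → Frame) (K : Config algorithm 3) (r : Fin 3) :
    output .LUMI F K r = (fun _ => (reaction F K r).1, (reaction F K r).2) := by
  simp only [output, snapshot, algorithm, Model.seesOwn, Model.seesOthers, if_true,
    Multiset.map_map, Function.comp_def, Option.map_some]
  rfl

theorem toLocal_real (F : Frame) {v : ℂ} (x : ℝ) (h : v = x) :
    F.toLocal v = x * F.toLocal 1 := by
  subst h
  unfold Frame.toLocal
  split_ifs
  · rw [← Complex.conj_ofReal x, ← map_mul]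
    congr 1
    rw [Complex.conj_ofReal]
    ring
  · ring

theorem toLocal_one_ne_zero (F : Frame) : F.toLocal 1 ≠ 0 := fun h => by
  have := F.toGlobal_toLocal 1
  rw [h, F.toGlobal_zero] at this
  exact zero_ne_one this

theorem toGlobal_real (F : Frame) {v : ℂ} (x : ℝ) (h : v = x) :
    F.toGlobal (v * F.toLocal 1) = v := by
  rw [h, ← toLocal_real F x rfl, F.toGlobal_toLocal]

theorem eq_cases (r : Fin 3) : r = 0 ∨ r = 1 ∨ r = 2 := by
  fin_cases r <;> simp

/-- What the robots see, in units of `1` in local coordinates. -/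
theorem reaction_eq (F : Fin 3 → Frame) (K : Config algorithm 3) {r s s' : Fin 3}
    (h : (Finset.univ.erase r).val = {s, s'}) {x x' : ℝ} (hx : K.pos s - K.pos r = x)
    (hx' : K.pos s' - K.pos r = x') {c c' d : Color} (hd : K.light r () = d)
    (hc : K.light s () = c) (hc' : K.light s' () = c') :
    reaction F K r = react (some d)
      {((x : ℂ) * (F r).toLocal 1, some c), ((x' : ℂ) * (F r).toLocal 1, some c')} := by
  rw [reaction, h, hd, Multiset.insert_eq_cons, Multiset.map_cons, Multiset.map_singleton,
    toLocal_real _ x hx, toLocal_real _ x' hx', hc, hc']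
  rfl

theorem reaction_first_one (F : Fin 3 → Frame) (j : Bool) :
    reaction F (stageConfig j 0) 1 =
      (some (some (some j)), (5 - (src j : ℂ)) * (F 1).toLocal 1) := by
  rw [← react_sightOne (x := (j, (F 1).toLocal 1)) (toLocal_one_ne_zero _),
    reaction_eq F _ (r := 1) (s := 0) (s' := 2) rfl (x := -src j) (x' := 1 - src j)
      (by simp [stageConfig, first]) (by simp [stageConfig, first]) rfl rfl rfl, sightOne]
  push_cast
  rfl

/-- Robots `0` and `2` also see two robots with initial lights, but the ratio of the two vectors
never occurs in the view of robot `1`. A match would make a nonzero number built from `src` vanish.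
-/
theorem reaction_first_of_ne (F : Fin 3 → Frame) (j : Bool) {r : Fin 3} (hr : r ≠ 1) :
    reaction F (stageConfig j 0) r = (none, 0) := by
  have hw := toLocal_one_ne_zero (F r)
  rcases eq_cases r with rfl | rfl | rfl
  · rw [reaction_eq F _ (r := 0) (s := 1) (s' := 2) rfl (x := src j) (x' := 1) (d := none)
      (c := none) (c' := none) (by simp [stageConfig, first])
      (by simp [stageConfig, first]) rfl rfl rfl]
    refine react_of_ne ?_ ?_
    · rintro ⟨k, z⟩ hz h
      rcases pair_eq_pair h with ⟨h1, h2⟩ | ⟨h1, h2⟩ <;>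
        simp only [Prod.mk.injEq, and_true, Complex.ofReal_one, one_mul] at h1 h2
      · have h3 : (F 0).toLocal 1 * ((src j - 1) * (src k - 1) - 1 : ℂ) = 0 := by
          linear_combination (src k - 1 : ℂ) * h1 - (src k : ℂ) * h2
        rcases mul_eq_zero.1 h3 with h4 | h4
        · exact hw h4
        · cases j <;> cases k <;> norm_num [src] at h4
      · have h3 : (F 0).toLocal 1 * ((src j - 1) * src k + 1 : ℂ) = 0 := by
          linear_combination (src k : ℂ) * h1 - (src k - 1 : ℂ) * h2
        rcases mul_eq_zero.1 h3 with h4 | h4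
        · exact hw h4
        · cases j <;> cases k <;> norm_num [src] at h4
    · rintro ⟨k, z⟩ hz h
      rcases pair_eq_pair h with ⟨h1, h2⟩ | ⟨h1, h2⟩ <;> simp at h1 h2
  · exact absurd rfl hr
  · rw [reaction_eq F _ (r := 2) (s := 0) (s' := 1) rfl (x := -1) (x' := src j - 1) (d := none)
      (c := none) (c' := none) (by simp [stageConfig, first])
      (by simp [stageConfig, first]) rfl rfl rfl]
    refine react_of_ne ?_ ?_
    · rintro ⟨k, z⟩ hz h
      rcases pair_eq_pair h with ⟨h1, h2⟩ | ⟨h1, h2⟩ <;>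
        simp only [Prod.mk.injEq, and_true] at h1 h2 <;> push_cast at h1 h2
      · have h3 : (F 2).toLocal 1 * (src j * src k - 1 : ℂ) = 0 := by
          linear_combination (1 - src k : ℂ) * h1 + (src k : ℂ) * h2
        rcases mul_eq_zero.1 h3 with h4 | h4
        · exact hw h4
        · cases j <;> cases k <;> norm_num [src] at h4
      · have h3 : (F 2).toLocal 1 * ((src k - 1) * src j + 1 : ℂ) = 0 := by
          linear_combination -(src k : ℂ) * h1 - (1 - src k : ℂ) * h2
        rcases mul_eq_zero.1 h3 with h4 | h4
        · exact hw h4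
        · cases j <;> cases k <;> norm_num [src] at h4
    · rintro ⟨k, z⟩ hz h
      rcases pair_eq_pair h with ⟨h1, h2⟩ | ⟨h1, h2⟩ <;> simp at h1 h2

theorem reaction_middle_zero (F : Fin 3 → Frame) (j : Bool) :
    reaction F (stageConfig j 1) 0 =
      (some (some none), -(dst j : ℂ) * (F 0).toLocal 1) := by
  rw [← react_sightZero (x := (j, (F 0).toLocal 1)) (toLocal_one_ne_zero _),
    reaction_eq F _ (r := 0) (s := 1) (s' := 2) rfl (x := 5) (x' := 1)
      (by simp [stageConfig, middle]) (by simp [stageConfig, middle]) rfl rfl rfl, sightZero]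
  simp [stageConfig]

theorem reaction_middle_of_ne (F : Fin 3 → Frame) (j : Bool) {r : Fin 3} (hr : r ≠ 0) :
    reaction F (stageConfig j 1) r = (none, 0) := by
  have hw := toLocal_one_ne_zero (F r)
  rcases eq_cases r with rfl | rfl | rfl
  · exact absurd rfl hr
  · exact react_of_on
  · rw [reaction_eq F _ (r := 2) (s := 0) (s' := 1) rfl (x := -1) (x' := 4) (d := none)
      (c := none) (c' := some (some j)) (by simp [stageConfig, middle])
      (by simp [stageConfig, middle]; norm_num) rfl rfl rfl]
    refine react_of_ne ?_ ?_
    · rintro ⟨k, z⟩ hz h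
      rcases pair_eq_pair h with ⟨h1, h2⟩ | ⟨h1, h2⟩ <;> simp at h1 h2
    · rintro ⟨k, z⟩ hz h
      rcases pair_eq_pair h with ⟨h1, h2⟩ | ⟨h1, h2⟩ <;> simp at h1 h2
      -- Robot `2` sees the others at `-w` and `4 * w`, whereas `sightZero` asks for `z` and `5 *
      -- z`; together they give `9 * w = 0`.
      refine hw ?_
      linear_combination (h2.1 - 5 * h1) / 9

theorem reaction_last (F : Fin 3 → Frame) (j : Bool) (r : Fin 3) :
    reaction F (stageConfig j 2) r = (none, 0) := by
  rcases eq_cases r with rfl | rfl | rfl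
  · exact react_of_on
  · exact react_of_on
  · rw [reaction_eq F _ (r := 2) (s := 0) (s' := 1) rfl (x := -dst j - 1) (x' := 4) (d := none)
      (c := some none) (c' := some (some j)) (by simp [stageConfig, last])
      (by simp [stageConfig, last]; norm_num) rfl rfl rfl]
    refine react_of_ne ?_ ?_ <;>
    · rintro ⟨k, z⟩ hz h
      rcases pair_eq_pair h with ⟨h1, h2⟩ | ⟨h1, h2⟩ <;> simp at h1 h2

/-! ### The relay advances when the robot whose move is due is active. -/

section Rounds

variable {δ : ℝ} {F : Fin 3 → Frame} {e : Set (Fin 3)} {K K' : Config algorithm 3}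

theorem round_of_reaction_eq (h : Round .LUMI true δ F e K K') {r : Fin 3}
    (hr : reaction F K r = (none, 0)) :
    K'.pos r = K.pos r ∧ K'.light r = K.light r := by
  by_cases hre : r ∈ e
  · obtain ⟨h1, h2⟩ := (h r).2 hre
    rw [output_algorithm, hr] at h1 h2
    simp only [Frame.toGlobal_zero, add_zero] at h1
    exact ⟨h1.eq_of_stay, funext h2⟩
  · exact (h r).1 hre

theorem round_of_mem (h : Round .LUMI true δ F e K K') {r : Fin 3} (hre : r ∈ e) :
    K'.pos r = K.pos r + (F r).toGlobal (reaction F K r).2 ∧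
      K'.light r () = (reaction F K r).1.getD (K.light r ()) := by
  obtain ⟨h1, h2⟩ := (h r).2 hre
  rw [output_algorithm] at h1 h2
  exact ⟨h1, h2 ()⟩

theorem config_eq_of_forall (h : ∀ r, K'.pos r = K.pos r ∧ K'.light r () = K.light r ()) :
    K' = K :=
  Config.ext' (funext fun r => (h r).1) (funext fun r => funext fun _ => (h r).2)

theorem round_first {j : Bool} (h : Round .LUMI true δ F e (stageConfig j 0) K') :
    (1 ∈ e → K' = stageConfig j 1) ∧ (1 ∉ e → K' = stageConfig j 0) := by
  have hne := fun r hr => round_of_reaction_eq h (reaction_first_of_ne F j (r := r) hr)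
  constructor
  · intro he
    obtain ⟨h1, h2⟩ := round_of_mem h he
    rw [reaction_first_one] at h1 h2
    refine config_eq_of_forall fun r => ?_
    by_cases hr : r = 1
    · subst hr
      refine ⟨?_, h2⟩
      rw [h1, toGlobal_real _ (5 - src j) (by push_cast; rfl)]
      simp [stageConfig, first, middle]
    · rw [(hne r hr).1, (hne r hr).2]
      fin_cases r
      · exact ⟨rfl, rfl⟩
      · exact absurd rfl hr
      · exact ⟨rfl, rfl⟩
  · intro he
    refine config_eq_of_forall fun r => ?_
    by_cases hr : r = 1
    · subst hr
      rw [((h 1).1 he).1, ((h 1).1 he).2]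
      exact ⟨rfl, rfl⟩
    · rw [(hne r hr).1, (hne r hr).2]
      exact ⟨rfl, rfl⟩

theorem round_middle {j : Bool} (h : Round .LUMI true δ F e (stageConfig j 1) K') :
    (0 ∈ e → K' = stageConfig j 2) ∧ (0 ∉ e → K' = stageConfig j 1) := by
  have hne := fun r hr => round_of_reaction_eq h (reaction_middle_of_ne F j (r := r) hr)
  constructor
  · intro he
    obtain ⟨h1, h2⟩ := round_of_mem h he
    rw [reaction_middle_zero] at h1 h2
    refine config_eq_of_forall fun r => ?_
    by_cases hr : r = 0
    · subst hr
      refine ⟨?_, h2⟩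
      rw [h1, toGlobal_real _ (-dst j) (by push_cast; rfl)]
      simp [stageConfig, middle, last]
    · rw [(hne r hr).1, (hne r hr).2]
      fin_cases r
      · exact absurd rfl hr
      · exact ⟨rfl, rfl⟩
      · exact ⟨rfl, rfl⟩
  · intro he
    refine config_eq_of_forall fun r => ?_
    by_cases hr : r = 0
    · subst hr
      rw [((h 0).1 he).1, ((h 0).1 he).2]
      exact ⟨rfl, rfl⟩
    · rw [(hne r hr).1, (hne r hr).2]
      exact ⟨rfl, rfl⟩

theorem round_last {j : Bool} (h : Round .LUMI true δ F e (stageConfig j 2) K') :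
    K' = stageConfig j 2 :=
  config_eq_of_forall fun r => by
    obtain ⟨h1, h2⟩ := round_of_reaction_eq h (reaction_last F j r)
    rw [h1, h2]
    exact ⟨rfl, rfl⟩

end Rounds

theorem validFrom_of_round {δ : ℝ} {F : Fin 3 → Frame} {e : ActivationSeq 3} (he : Fair e)
    {K : ℕ → Config algorithm 3} {j : Bool} (h0 : K 0 = stageConfig j 0)
    (hK : ∀ t, Round .LUMI true δ F (e t) (K t) (K (t + 1))) :
    ValidFrom j fun t => (K t).pos := by
  have hlast : ∀ t, K t = stageConfig j 2 → ∀ s, t ≤ s → K s = stageConfig j 2 := by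
    intro t ht s hs
    induction s, hs using Nat.le_induction with
    | base => exact ht
    | succ s _ ih => exact round_last (ih ▸ hK s)
  have hmid : ∀ t, K t = stageConfig j 1 → ∀ s, t ≤ s →
      K s = stageConfig j 1 ∨ K s = stageConfig j 2 := by
    intro t ht s hs
    induction s, hs using Nat.le_induction with
    | base => exact Or.inl ht
    | succ s _ ih =>
      rcases ih with ih | ih
      · by_cases h : 0 ∈ e s
        · exact Or.inr ((round_middle (ih ▸ hK s)).1 h)
        · exact Or.inl ((round_middle (ih ▸ hK s)).2 h)
      · exact Or.inr (round_last (ih ▸ hK s))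
  have hrange : ∀ t, K t = stageConfig j 0 ∨ K t = stageConfig j 1 ∨ K t = stageConfig j 2 := by
    intro t
    induction t with
    | zero => exact Or.inl h0
    | succ t ih =>
      rcases ih with ih | ih | ih
      · by_cases h : 1 ∈ e t
        · exact Or.inr (Or.inl ((round_first (ih ▸ hK t)).1 h))
        · exact Or.inl ((round_first (ih ▸ hK t)).2 h)
      · exact Or.inr (hmid t ih _ (by omega))
      · exact Or.inr (Or.inr (hlast t ih _ (by omega)))
  refine ⟨by rw [h0]; rfl, fun t => ?_, fun t t' htt' ht => ?_, ?_⟩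
  · rcases hrange t with h | h | h <;> rw [h]
    · exact Or.inl rfl
    · exact Or.inr (Or.inl rfl)
    · exact Or.inr (Or.inr rfl)
  · have : K t = stageConfig j 1 := by
      rcases hrange t with h | h | h <;> rw [h] at ht
      · exact absurd ht (first_ne_middle j)
      · exact h
      · exact absurd ht.symm (middle_ne_last j)
    rcases hmid t this t' htt' with h | h <;> rw [h]
    · exact Or.inl rfl
    · exact Or.inr rfl
  · obtain ⟨s, -, hs⟩ := he.exists_ge 1 0
    have h1 : K (s + 1) = stageConfig j 1 ∨ K (s + 1) = stageConfig j 2 := by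
      rcases hrange s with h | h | h
      · exact Or.inl ((round_first (h ▸ hK s)).1 hs)
      · exact hmid s h _ (by omega)
      · exact Or.inr (hlast s h _ (by omega))
    obtain ⟨u, hu, hu'⟩ := he.exists_ge 0 (s + 1)
    have h2 : K (u + 1) = stageConfig j 2 := by
      have : K u = stageConfig j 1 ∨ K u = stageConfig j 2 := by
        rcases h1 with h1 | h1
        · exact hmid _ h1 u hu
        · exact Or.inr (hlast _ h1 u hu)
      rcases this with h | h
      · exact (round_middle (h ▸ hK u)).1 hu'
      · exact hlast u h _ (by omega)
    exact ⟨u + 1, fun t ht => by rw [hlast _ h2 t ht]; rfl⟩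

theorem problem_mem_lumi : problem ∈ Task .LUMI RSYNCH (disoriented 3 (by omega)) := by
  refine ⟨algorithm, ?_⟩
  rintro F - δ - e he K ⟨j, hj⟩ hoff hK
  exact ⟨j, validFrom_of_round he.1.1 (Config.ext' hj.symm (funext hoff)) hK⟩

end Relay

end LCMRobots

theorem mainTheorem1 :
    (LCMRobots.Equivalent .FCOM LCMRobots.RSYNCH .LUMI LCMRobots.RSYNCH ∧
      LCMRobots.Equivalent .LUMI LCMRobots.RSYNCH .LUMI LCMRobots.SSYNCH) ∧
    (LCMRobots.MorePowerful .FCOM LCMRobots.RSYNCH .FSTA LCMRobots.RSYNCH ∧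
      LCMRobots.MorePowerful .FSTA LCMRobots.RSYNCH .OBLOT LCMRobots.RSYNCH) := by
  -- The two simulations are composed, with `LUMI` under `SSYNCH` in between.
  have hFL : LCMRobots.NotLessPowerful .FCOM LCMRobots.RSYNCH .LUMI LCMRobots.RSYNCH := fun R =>
    (LCMRobots.lumi_SSYNCH_notLessPowerful_lumi_RSYNCH R).trans
      (LCMRobots.fcom_RSYNCH_notLessPowerful_lumi_SSYNCH R)
  have hLF : LCMRobots.NotLessPowerful .LUMI LCMRobots.RSYNCH .FSTA LCMRobots.RSYNCH :=
    LCMRobots.notLessPowerful_of_sees _ (fun _ => rfl) fun _ => rfl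
  refine ⟨⟨⟨hFL, LCMRobots.notLessPowerful_of_sees _ (fun _ => rfl) fun _ => rfl⟩,
    LCMRobots.notLessPowerful_of_subset fun _ _ h => h.1,
    LCMRobots.lumi_SSYNCH_notLessPowerful_lumi_RSYNCH⟩,
    ⟨fun R => (hLF R).trans (hFL R), LCMRobots.disoriented 3 (by omega), LCMRobots.Relay.problem,
      hFL _ LCMRobots.Relay.problem_mem_lumi, LCMRobots.Relay.problem_notMem_fsta⟩,
    LCMRobots.notLessPowerful_of_sees _ (fun _ => rfl) fun h => h, LCMRobots.disoriented 2 le_rfl,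
    LCMRobots.moveAndStop 2, ⟨LCMRobots.moveOnce, LCMRobots.moveOnce_solves le_rfl⟩,
    LCMRobots.moveAndStop_notMem_oblot le_rfl⟩
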